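/- Let $G$ be a finite-dimensional real Lie group with Lie algebra $\mathfrak g$, with a left-invariant metric given by an inner product $g$ on $\mathfrak g$; let $e_1,\dots,e_n$ be a basis of $\mathfrak g$, also denoting the corresponding left-invariant vector fields, and write $\sharp:\mathfrak g^*\to\mathfrak g$ for raising indices with $g$. Let $H(y)=\tfrac12|y|^2$ on $\mathfrak g^*$, so that the Euler–Arnold equation is $\dot y_k=b_k(y)$ with $b_k(y)=\{H,y_k\}$, i.e. $b(y)(w)=y([\sharp y,w])$; in $\mathfrak g$, for $z=\sharp y$, it reads $\dot z=q(z,z)$ with $g(q(z,z),w)=g([z,w],z)$. Let $M\subset\mathfrak g^*$ be a non-empty, connected, real-analytic embedded submanifold of dimension $d$ that is invariant under the evolution by the Euler–Arnold equation, and let $Z=\sharp M\subset\mathfrak g$. Let $m$ be a measure on $M$ with a smooth positive density, let $L_M$ be the Laplace operator on $M$ of the metric that is conformal to the metric induced on $M$ by $g$ and (if $d\ge 1$) has volume element $m$, and let $L$ be the corresponding operator on $Z$ (for $d=0$, $L_M=L=0$). Let $\varepsilon>0$, and consider the Fokker–Planck operators $$f\mapsto f_t+v^k e_kf+b_k\frac{\partial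 f}{\partial y_k}-\frac{\varepsilon^2}{2}L_Mf\quad\text{on } G\times M,\qquad v=\sharp y,$$ $$f\mapsto f_t+z^ke_kf+q^k(z,z)\frac{\partial f}{\partial z^k}-\frac{\varepsilon^2}{2}Lf\quad\text{on } G\times Z .$$ Such an operator satisfies the parabolic Hörmander condition if near every point $p$ it can be written as $\partial_t+X_0-\sum_{j=1}^{r}X_j^2$ with smooth vector fields $X_0,\dots,X_r$ such that the values at $p$ of the fields in $\mathcal M$ fill the whole tangent space at $p$, where $\mathcal M$ is the smallest set of vector fields near $p$ that contains $X_1,\dots,X_r$, is a module over the smooth functions, is closed under Lie brackets and is invariant under $X\mapsto[X_0,X]$. The p-hull of a set $S\subset\mathfrak g$ is the smallest Lie subalgebra $\mathfrak h\subset\mathfrak g$ that contains $S-S=\{s_1-s_2: s_1,s_2\in S\}$ and is invariant under $\operatorname{ad}s: z\mapsto[s,z]$ for each $s\in S$. Then the operator on $G\times M$ satisfies the parabolic Hörmander condition if and only if the p-hull of $Z$ is $\mathfrak g$; equivalently, the operator on $G\times Z$ satisfies the parabolic Hörmander condition if and only if the p-hull of $Z$ is $\mathfrak g$. -/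

import Mathlib

open Set
open scoped Manifold ContDiff Topology

noncomputable section

/-! ### Metric tensors on a finite-dimensional vector space -/

/-- A (positive definite) metric tensor `g` on a real vector space `V`. -/
structure MetricTensor (V : Type*) [AddCommGroup V] [Module ℝ V] where
  /-- the bilinear form `(x, y) ↦ g(x, y)` -/
  form : V →ₗ[ℝ] V →ₗ[ℝ] ℝ
  symm : ∀ x y, form x y = form y x
  pos : ∀ x, x ≠ 0 → 0 < form x x

namespace MetricTensor

theorem form_injective {V : Type*} [AddCommGroup V] [Module ℝ V] (g : MetricTensor V) :
    Function.Injective g.form := by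
  refine (injective_iff_map_eq_zero _).2 fun x hx => ?_
  by_contra h
  have := g.pos x h
  simp [hx] at this

variable {V : Type*} [AddCommGroup V] [Module ℝ V] [TopologicalSpace V]
  [IsTopologicalAddGroup V] [ContinuousSMul ℝ V] [T2Space V] [FiniteDimensional ℝ V]

/-- Lowering indices, `♭ : V → V*`, `♭ x = g(x, ·)`. -/
def flat (g : MetricTensor V) : V ≃ₗ[ℝ] StrongDual ℝ V :=
  (LinearEquiv.ofInjectiveOfFinrankEq (V' := Module.Dual ℝ V) g.form g.form_injective
    Subspace.dual_finrank_eq.symm).trans LinearMap.toContinuousLinearMap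

/-- Raising indices, `♯ : V* → V`, the inverse of `♭`. -/
def sharp (g : MetricTensor V) : StrongDual ℝ V ≃ₗ[ℝ] V := g.flat.symm

theorem flat_apply (g : MetricTensor V) (x w : V) : g.flat x w = g.form x w := rfl

theorem form_sharp (g : MetricTensor V) (y : StrongDual ℝ V) (w : V) :
    g.form (g.sharp y) w = y w := by
  rw [← flat_apply, sharp, LinearEquiv.apply_symm_apply]

/-- The metric on `V*` dual to `g`: `g*(y, y') = g(♯ y, ♯ y')`. -/
def dual (g : MetricTensor V) : MetricTensor (StrongDual ℝ V) where
  form := g.form.compl₁₂ g.sharp.toLinearMap g.sharp.toLinearMap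
  symm x y := g.symm _ _
  pos x hx := g.pos _ (by simpa using hx)

end MetricTensor

/-! ### Real-analytic submanifolds, invariance under a flow -/

/-- `ψ : U → S` is a real-analytic local parametrization of the `d`-dimensional embedded
submanifold `S` of the finite-dimensional space `W`: `U ⊆ ℝ^d` is open, `ψ` is a real-analytic
immersion on `U` (its components with respect to all linear functionals are analytic) with values
in `S`, and it is a homeomorphism from `U` onto a relatively open subset of `S`. -/
structure IsLocalParam {W : Type*} [AddCommGroup W] [Module ℝ W] [TopologicalSpace W] {d : ℕ}
    (S : Set W) (U : Set (EuclideanSpace ℝ (Fin d))) (ψ : EuclideanSpace ℝ (Fin d) → W) :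
    Prop where
  isOpen : IsOpen U
  analytic : ∀ l : StrongDual ℝ W, AnalyticOnNhd ℝ (fun x => l (ψ x)) U
  immersion : ∀ x ∈ U, Function.Injective (fderiv ℝ ψ x)
  mapsTo : MapsTo ψ U S
  isOpenEmbedding : Topology.IsOpenEmbedding (mapsTo.restrict ψ U S)

/-- `S` is a `d`-dimensional real-analytic embedded submanifold of `W`. -/
def IsAnalyticSubmanifold {W : Type*} [AddCommGroup W] [Module ℝ W] [TopologicalSpace W]
    (d : ℕ) (S : Set W) : Prop :=
  ∀ y ∈ S, ∃ (U : Set (EuclideanSpace ℝ (Fin d))) (ψ : EuclideanSpace ℝ (Fin d) → W),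
    IsLocalParam S U ψ ∧ y ∈ ψ '' U

/-- `ρ` restricts to a smooth positive function on the `d`-dimensional submanifold `S`. -/
def IsSmoothPositiveOn {W : Type*} [AddCommGroup W] [Module ℝ W] [TopologicalSpace W]
    (d : ℕ) (S : Set W) (ρ : W → ℝ) : Prop :=
  (∀ y ∈ S, 0 < ρ y) ∧
  ∀ (U : Set (EuclideanSpace ℝ (Fin d))) (ψ : EuclideanSpace ℝ (Fin d) → W),
    IsLocalParam S U ψ → ContDiffOn ℝ ∞ (fun x => ρ (ψ x)) U

/-- `S` is invariant under the evolution by `ẏ = B(y)`: a solution starting in `S` stays in `S`. -/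
def IsFlowInvariant {W : Type*} [AddCommGroup W] [Module ℝ W] [TopologicalSpace W]
    [ContinuousSMul ℝ W] (B : W → W) (S : Set W) : Prop :=
  ∀ (T : ℝ) (y : ℝ → W), 0 ≤ T →
    (∀ t ∈ Icc 0 T, HasDerivWithinAt y (B (y t)) (Icc 0 T) t) → y 0 ∈ S → y T ∈ S

/-! ### Riemannian geometry in local coordinates -/

/-- The partial derivative `∂u/∂x^i` at `x`. -/
def partialDeriv {d : ℕ} {W : Type*} [AddCommGroup W] [Module ℝ W] [TopologicalSpace W]
    (i : Fin d) (u : EuclideanSpace ℝ (Fin d) → W) (x : EuclideanSpace ℝ (Fin d)) : W :=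
  fderiv ℝ u x (EuclideanSpace.single i 1)

/-- The metric induced on a submanifold in the coordinates given by `ψ`,
`g̃_ij = g(∂_i ψ, ∂_j ψ)`. -/
def inducedMetric {W : Type*} [AddCommGroup W] [Module ℝ W] [TopologicalSpace W] {d : ℕ}
    (g : MetricTensor W) (ψ : EuclideanSpace ℝ (Fin d) → W) (x : EuclideanSpace ℝ (Fin d)) :
    Matrix (Fin d) (Fin d) ℝ :=
  Matrix.of fun i j => g.form (partialDeriv i ψ x) (partialDeriv j ψ x)

/-- The metric `h_ij = ϰ g̃_ij` conformal to the induced metric `g̃` and whose volume element is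
the measure `m = ρ · vol(g̃)`, i.e. `√(det h) = ρ √(det g̃)`; so `ϰ = ρ^(2/d)`. -/
def conformalMetric {W : Type*} [AddCommGroup W] [Module ℝ W] [TopologicalSpace W] {d : ℕ}
    (g : MetricTensor W) (ρ : W → ℝ) (ψ : EuclideanSpace ℝ (Fin d) → W)
    (x : EuclideanSpace ℝ (Fin d)) : Matrix (Fin d) (Fin d) ℝ :=
  (ρ (ψ x) ^ (2 / (d : ℝ))) • inducedMetric g ψ x

/-- The Laplace operator of the metric `h` in local coordinates,
`(1/√h) ∂_i (√h h^{ij} ∂_j u)`. -/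
def laplaceBeltrami {d : ℕ} (h : EuclideanSpace ℝ (Fin d) → Matrix (Fin d) (Fin d) ℝ)
    (u : EuclideanSpace ℝ (Fin d) → ℝ) (x : EuclideanSpace ℝ (Fin d)) : ℝ :=
  (√(h x).det)⁻¹ *
    ∑ i, partialDeriv i (fun y => √(h y).det * ∑ j, (h y)⁻¹ i j * partialDeriv j u y) x

/-- The vector field `B` along a submanifold, tangent to it, expressed in the coordinates given
by `ψ`: the vector `b(x) ∈ ℝ^d` with `Dψ(x) b(x) = B(ψ(x))`. -/
def coordField {W : Type*} [AddCommGroup W] [Module ℝ W] [TopologicalSpace W] {d : ℕ}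
    (B : W → W) (ψ : EuclideanSpace ℝ (Fin d) → W) (x : EuclideanSpace ℝ (Fin d)) :
    EuclideanSpace ℝ (Fin d) :=
  Function.invFun (fderiv ℝ ψ x) (B (ψ x))

/-! ### The parabolic Hörmander condition -/

section Hormander

variable {F : Type*} [NormedAddCommGroup F] [NormedSpace ℝ F]
  {H : Type*} [TopologicalSpace H] {I : ModelWithCorners ℝ F H}
  {N : Type*} [TopologicalSpace N] [ChartedSpace H N]

/-- The derivative `X f` of a function `f` along a vector field `X` on the manifold `N`. -/
def applyField (X : ∀ p : N, TangentSpace I p) (f : N → ℝ) (p : N) : ℝ :=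
  mfderiv I 𝓘(ℝ, ℝ) f p (X p)

/-- `X` is a smooth vector field on the open set `Ω`. -/
def IsSmoothField [IsManifold I ∞ N] (Ω : Set N) (X : ∀ p : N, TangentSpace I p) : Prop :=
  ContMDiffOn I I.tangent ∞ (fun p => (⟨p, X p⟩ : TangentBundle I N)) Ω

/-- The smallest family of vector fields on the open set `Ω` that contains `X_1, …, X_m`, is a
module over the smooth functions, is closed under Lie brackets, and is invariant under the map
`X ↦ [X_0, X]`. (Values outside `Ω` are irrelevant.) -/
inductive ParabolicLieModule (Ω : Set N) (X₀ : ∀ p : N, TangentSpace I p) {m : ℕ}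
    (X : Fin m → ∀ p : N, TangentSpace I p) : (∀ p : N, TangentSpace I p) → Prop
  | field (j : Fin m) : ParabolicLieModule Ω X₀ X (X j)
  | zero : ParabolicLieModule Ω X₀ X (fun _ => 0)
  | add (A B : ∀ p : N, TangentSpace I p) :
      ParabolicLieModule Ω X₀ X A → ParabolicLieModule Ω X₀ X B →
      ParabolicLieModule Ω X₀ X (fun p => A p + B p)
  | smul (φ : N → ℝ) (A : ∀ p : N, TangentSpace I p) :
      ContMDiffOn I 𝓘(ℝ, ℝ) ∞ φ Ω → ParabolicLieModule Ω X₀ X A →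
      ParabolicLieModule Ω X₀ X (fun p => φ p • A p)
  | lie (A B : ∀ p : N, TangentSpace I p) :
      ParabolicLieModule Ω X₀ X A → ParabolicLieModule Ω X₀ X B →
      ParabolicLieModule Ω X₀ X (VectorField.mlieBracket I A B)
  | ad (A : ∀ p : N, TangentSpace I p) :
      ParabolicLieModule Ω X₀ X A →
      ParabolicLieModule Ω X₀ X (VectorField.mlieBracket I X₀ A)

/-- On the open set `Ω` the operator `P`, acting on functions of `(t, p) ∈ ℝ × N`, has the form
`P f = ∂_t f + X_0 f - ∑_j X_j² f` with smooth vector fields `X_0, …, X_m`. -/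
structure IsSumOfSquares (I : ModelWithCorners ℝ F H) [IsManifold I ∞ N]
    (P : (ℝ × N → ℝ) → ℝ × N → ℝ) (Ω : Set N) (X₀ : ∀ p : N, TangentSpace I p) {m : ℕ}
    (X : Fin m → ∀ p : N, TangentSpace I p) : Prop where
  smooth_zero : IsSmoothField Ω X₀
  smooth : ∀ j, IsSmoothField Ω (X j)
  eq : ∀ f : ℝ × N → ℝ, ContMDiffOn (𝓘(ℝ, ℝ).prod I) 𝓘(ℝ, ℝ) ∞ f (univ ×ˢ Ω) →
    ∀ t : ℝ, ∀ p ∈ Ω, P f (t, p) = deriv (fun s => f (s, p)) t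
      + applyField X₀ (fun q => f (t, q)) p
      - ∑ j, applyField (X j) (applyField (X j) fun q => f (t, q)) p

/-- The parabolic Hörmander condition for the operator `P` at all points of the open set `D`: near
each point `p` of `D` it can be written as `∂_t + X_0 - ∑_j X_j²`, where the fields of the smallest
Lie module that contains `X_1, …, X_m` and is invariant under `X ↦ [X_0, X]` exhaust the tangent
space at `p`. -/
def ParabolicHormander (I : ModelWithCorners ℝ F H) [IsManifold I ∞ N]
    (P : (ℝ × N → ℝ) → ℝ × N → ℝ) (D : Set N) : Prop :=
  ∀ p ∈ D, ∃ Ω : Set N, IsOpen Ω ∧ p ∈ Ω ∧ Ω ⊆ D ∧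
    ∃ (m : ℕ) (X₀ : ∀ p : N, TangentSpace I p) (X : Fin m → ∀ p : N, TangentSpace I p),
      IsSumOfSquares I P Ω X₀ X ∧
      ∀ v : TangentSpace I p, ∃ A, ParabolicLieModule Ω X₀ X A ∧ A p = v

end Hormander

/-! ### The group, the Euler-Arnold equation, the p-hull and the Fokker-Planck operators -/

section Group

variable (E : Type*) [NormedAddCommGroup E] [NormedSpace ℝ E]
  (G : Type*) [TopologicalSpace G] [ChartedSpace E G] [Group G]

/-- The Lie algebra `𝔤 = T_1 G` (with the bracket of left-invariant vector fields). -/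
abbrev LieAlgOf : Type _ := GroupLieAlgebra 𝓘(ℝ, E) G

instance instFiniteDimensionalLieAlgOf [FiniteDimensional ℝ E] :
    FiniteDimensional ℝ (LieAlgOf E G) :=
  inferInstanceAs (FiniteDimensional ℝ E)

instance instT2SpaceLieAlgOf : T2Space (LieAlgOf E G) :=
  inferInstanceAs (T2Space E)

instance instLieGroupMinSmoothness [LieGroup 𝓘(ℝ, E) ∞ G] :
    LieGroup 𝓘(ℝ, E) (minSmoothness ℝ 3) G := by
  rw [minSmoothness_of_isRCLikeNormedField]; infer_instance

variable {E G}

/-- The p-hull of `S ⊆ 𝔤`: the smallest Lie subalgebra that contains `S - S` and is invariant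
under `ad s` for every `s ∈ S`. -/
def pHull [FiniteDimensional ℝ E] [LieGroup 𝓘(ℝ, E) ∞ G] (S : Set (LieAlgOf E G)) :
    LieSubalgebra ℝ (LieAlgOf E G) :=
  sInf {𝔥 | (∀ s₁ ∈ S, ∀ s₂ ∈ S, s₁ - s₂ ∈ 𝔥) ∧ ∀ s ∈ S, ∀ z ∈ 𝔥, ⁅s, z⁆ ∈ 𝔥}

/-- The right-hand side of the Euler-Arnold equation `ẏ_k = {H, y_k} = y_l c^l_{jk} ∂H/∂y_j` on
`𝔤*` for `H(y) = |y|²/2`, for which `∂H/∂y_j = y^j`: the covector `w ↦ y([♯ y, w])`. -/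
def eulerArnold [FiniteDimensional ℝ E] [LieGroup 𝓘(ℝ, E) ∞ G]
    (g : MetricTensor (LieAlgOf E G)) (y : StrongDual ℝ (LieAlgOf E G)) :
    StrongDual ℝ (LieAlgOf E G) :=
  LinearMap.toContinuousLinearMap
    (y.toLinearMap ∘ₗ (LieAlgebra.ad ℝ (LieAlgOf E G) (g.sharp y)))

/-- The form `q̃` on `𝔤` given by `g([x, y], z) = g(q̃(z, x), y)`. -/
def arnoldForm [FiniteDimensional ℝ E] [LieGroup 𝓘(ℝ, E) ∞ G]
    (g : MetricTensor (LieAlgOf E G)) (z x : LieAlgOf E G) : LieAlgOf E G :=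
  g.sharp (LinearMap.toContinuousLinearMap
    ((g.form z) ∘ₗ (LieAlgebra.ad ℝ (LieAlgOf E G) x)))

/-- The symmetrization `q(x, y) = (q̃(x, y) + q̃(y, x)) / 2`; the Euler-Arnold equation in `𝔤` is
`ż = q(z, z)`. -/
def symmArnoldForm [FiniteDimensional ℝ E] [LieGroup 𝓘(ℝ, E) ∞ G]
    (g : MetricTensor (LieAlgOf E G)) (x y : LieAlgOf E G) : LieAlgOf E G :=
  (1 / 2 : ℝ) • (arnoldForm g x y + arnoldForm g y x)

/-- In the coordinates `(a, x) ∈ G × U` on `G × S` given by a parametrization `ψ` of `S`, the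
Fokker-Planck operator
`f ↦ f_t + v^k e_k f + B · ∂f/∂y - (ε²/2) L f`,
where `v : S → 𝔤` is the velocity, `e_k` are left-invariant fields, `B` is a tangent field on `S`
and `L` is the Laplace operator on `S` for the metric that is conformal to the metric induced by
`gW` and has volume element `ρ` times the induced one. -/
def fokkerPlanck {W : Type*} [AddCommGroup W] [Module ℝ W] [TopologicalSpace W] {d : ℕ}
    (gW : MetricTensor W) (ρ : W → ℝ) (v : W → LieAlgOf E G) (B : W → W) (ε : ℝ)
    (ψ : EuclideanSpace ℝ (Fin d) → W) (f : ℝ × (G × EuclideanSpace ℝ (Fin d)) → ℝ) :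
    ℝ × (G × EuclideanSpace ℝ (Fin d)) → ℝ := fun (t, (a, x)) =>
  deriv (fun s => f (s, (a, x))) t
  + applyField (I := 𝓘(ℝ, E)) (mulInvariantVectorField (v (ψ x))) (fun b => f (t, (b, x))) a
  + fderiv ℝ (fun y => f (t, (a, y))) x (coordField B ψ x)
  - ε ^ 2 / 2 * laplaceBeltrami (conformalMetric gW ρ ψ) (fun y => f (t, (a, y))) x

/-- The Fokker-Planck operator on `G × S` with the given data satisfies the parabolic Hörmander
condition (at every point, in all the local coordinates of `S`). -/
def FokkerPlanckHormander [LieGroup 𝓘(ℝ, E) ∞ G]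
    {W : Type*} [AddCommGroup W] [Module ℝ W] [TopologicalSpace W]
    (d : ℕ) (S : Set W) (gW : MetricTensor W) (ρ : W → ℝ) (v : W → LieAlgOf E G) (B : W → W)
    (ε : ℝ) : Prop :=
  ∀ (U : Set (EuclideanSpace ℝ (Fin d))) (ψ : EuclideanSpace ℝ (Fin d) → W),
    IsLocalParam S U ψ →
    ParabolicHormander (𝓘(ℝ, E).prod 𝓘(ℝ, EuclideanSpace ℝ (Fin d)))
      (fokkerPlanck (G := G) gW ρ v B ε ψ) ((univ : Set G) ×ˢ U)

end Group

end

/-!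
The fields of the parabolic Lie module are compared with left-invariant ones. In the left-invariant
trivialization a tangent vector of `G × ℝ^d` is a pair `(w, y)` with `w ∈ 𝔤` (`frameMap`), and the
brackets of the constant fields `(w, y)`, `(w', y')` are `([w, w'], 0)`.

*Necessity.* Suppose that the operator is `∂_t + X_0 - ∑ X_j²`. Applied to functions of the group
variable only, it is the derivative along the velocity `v`, a field of first order. Hence the `X_j`
have no component along `G` (`IsSumOfSquares.fst_eq_zero`), and the component of `X_0` along `G` is
`v` (`IsSumOfSquares.fst_eq_velocity`). Near a point with velocity `s`, the fields whose components
along `G` lie in the p-hull `𝔥` form a module that contains the `X_j` and `X_0 - e_s`, is closed under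
brackets because `𝔥` is a subalgebra, and is stable under `[e_s, ·]` because `𝔥` is stable under
`ad s`. So it contains the parabolic Lie module, and if the latter fills the tangent space, `𝔥 = 𝔤`
(`pHull_eq_top_of_parabolicHormander`).

*Sufficiency.* A factorization `h = T Tᵀ` of the conformal metric yields fields `σ_k` on the
coordinate domain that span `ℝ^d` and satisfy `∑ σ_k ⊗ σ_k = (ε²/2) h⁻¹`; the Laplace operator is
`∑ σ_k² + ∑ (div σ_k) σ_k` up to the factor `ε²/2` (`laplaceBeltrami_eq_sum_sq`), which puts the
operator in the form of a sum of squares with `X_0 = v + c`, `c` along `ℝ^d`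
(`isSumOfSquares_fokkerPlanck`). Here `c` is smooth because the drift is tangent to the submanifold,
which follows from the invariance under its flow (`IsFlowInvariant.mem_range_fderiv`). The module
contains all fields along `ℝ^d`, hence it is stable under brackets with `v` itself, and it contains
the derivatives of `v` of all orders `≥ 1` in the directions of `ℝ^d`. By analyticity and
connectedness, a linear functional that annihilates these derivatives at one point is constant on the
set `S` of velocities (`eq_of_iteratedFDeriv_eq_zero`), so the derivatives span `S - S`, and the
left-invariant fields from `S - S` belong to the module near the point
(`exists_inFrameModule_const_of_mem_span`). The elements of `𝔤` whose left-invariant fields belong to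
the module form a subalgebra, which is stable under `ad s` for `s ∈ S` since `[s, z]` differs from
`[v, z]` by brackets of `z` with elements of `S - S`; so it contains the p-hull
(`inFrameModule_const_of_mem_pHull`).

The operator on `G × Z` is of the same form, with the identity map as the velocity: `♯` is a linear
isomorphism that takes the Euler-Arnold equation on `𝔤*` to the one on `𝔤`.
-/

noncomputable section

set_option linter.unusedSectionVars false

/-! ### Lie brackets on products -/

theorem ContinuousLinearMap.IsInvertible.inverse_prodMap_apply {E E' F F' : Type*}
    [NormedAddCommGroup E] [NormedSpace ℝ E] [NormedAddCommGroup E'] [NormedSpace ℝ E']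
    [NormedAddCommGroup F] [NormedSpace ℝ F] [NormedAddCommGroup F'] [NormedSpace ℝ F']
    {A : E →L[ℝ] E'} {B : F →L[ℝ] F'} (hA : A.IsInvertible) (hB : B.IsInvertible)
    (x : E' × F') : (A.prodMap B).inverse x = (A.inverse x.1, B.inverse x.2) := by
  obtain ⟨a, rfl⟩ := hA
  obtain ⟨b, rfl⟩ := hB
  have : ((a : E →L[ℝ] E').prodMap (b : F →L[ℝ] F')) = ((a.prodCongr b : _ ≃L[ℝ] _) : _ →L[ℝ] _) := by
    ext <;> rfl
  rw [this]
  simp only [ContinuousLinearMap.inverse_equiv]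
  rfl

theorem VectorField.lieBracketWithin_univ_prod {E F : Type*}
    [NormedAddCommGroup E] [NormedSpace ℝ E] [NormedAddCommGroup F] [NormedSpace ℝ F]
    {A B : E → E} {A' B' : F → F} {P Q : E × F → E × F} {z : E × F}
    (hP : P =ᶠ[𝓝 z] fun z => (A z.1, A' z.2)) (hQ : Q =ᶠ[𝓝 z] fun z => (B z.1, B' z.2))
    (hA : DifferentiableWithinAt ℝ A univ z.1) (hB : DifferentiableWithinAt ℝ B univ z.1)
    (hA' : DifferentiableWithinAt ℝ A' univ z.2) (hB' : DifferentiableWithinAt ℝ B' univ z.2) :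
    lieBracketWithin ℝ P Q univ z =
      (lieBracketWithin ℝ A B univ z.1, lieBracketWithin ℝ A' B' univ z.2) := by
  simp only [lieBracketWithin_univ, differentiableWithinAt_univ] at *
  rw [hP.lieBracket_vectorField_eq hQ]
  have h1 := (hA.hasFDerivAt.comp z hasFDerivAt_fst).prodMk (hA'.hasFDerivAt.comp z hasFDerivAt_snd)
  have h2 := (hB.hasFDerivAt.comp z hasFDerivAt_fst).prodMk (hB'.hasFDerivAt.comp z hasFDerivAt_snd)
  simp only [Function.comp_def] at h1 h2
  rw [lieBracket_eq]
  dsimp only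
  rw [h1.fderiv, h2.fderiv]
  rfl

section ProductBracket

variable {E : Type*} [NormedAddCommGroup E] [NormedSpace ℝ E] [CompleteSpace E]
  {F : Type*} [NormedAddCommGroup F] [NormedSpace ℝ F] [CompleteSpace F]
  {M : Type*} [TopologicalSpace M] [ChartedSpace E M] [IsManifold 𝓘(ℝ, E) ∞ M]
  {M' : Type*} [TopologicalSpace M'] [ChartedSpace F M'] [IsManifold 𝓘(ℝ, F) ∞ M']

/-- The vector field `(V, V')` on the product `M × M'`. -/
def prodField (V : ∀ p : M, TangentSpace 𝓘(ℝ, E) p) (V' : ∀ p : M', TangentSpace 𝓘(ℝ, F) p)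
    (q : M × M') : TangentSpace (𝓘(ℝ, E).prod 𝓘(ℝ, F)) q :=
  ((V q.1, V' q.2) : E × F)

/-- Vector fields on the two factors of a product are bracketed separately. -/
theorem mlieBracket_prod {V W : ∀ p : M, TangentSpace 𝓘(ℝ, E) p}
    {V' W' : ∀ p : M', TangentSpace 𝓘(ℝ, F) p} {p : M × M'}
    (hV : MDifferentiableAt 𝓘(ℝ, E) 𝓘(ℝ, E).tangent
      (fun x => (⟨x, V x⟩ : TangentBundle 𝓘(ℝ, E) M)) p.1)
    (hW : MDifferentiableAt 𝓘(ℝ, E) 𝓘(ℝ, E).tangent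
      (fun x => (⟨x, W x⟩ : TangentBundle 𝓘(ℝ, E) M)) p.1)
    (hV' : MDifferentiableAt 𝓘(ℝ, F) 𝓘(ℝ, F).tangent
      (fun x => (⟨x, V' x⟩ : TangentBundle 𝓘(ℝ, F) M')) p.2)
    (hW' : MDifferentiableAt 𝓘(ℝ, F) 𝓘(ℝ, F).tangent
      (fun x => (⟨x, W' x⟩ : TangentBundle 𝓘(ℝ, F) M')) p.2) :
    VectorField.mlieBracket (𝓘(ℝ, E).prod 𝓘(ℝ, F))
      (prodField V V') (prodField W W') p =
      ((VectorField.mlieBracket 𝓘(ℝ, E) V W p.1,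
        VectorField.mlieBracket 𝓘(ℝ, F) V' W' p.2) : E × F) := by
  have : IsManifold 𝓘(ℝ, E) 1 M := .of_le (n := ∞) (by simp)
  have : IsManifold 𝓘(ℝ, F) 1 M' := .of_le (n := ∞) (by simp)
  have : IsManifold 𝓘(ℝ, E) 2 M := .of_le (n := ∞) (by norm_cast)
  have : IsManifold 𝓘(ℝ, F) 2 M' := .of_le (n := ∞) (by norm_cast)
  have pull (V : ∀ p : M, TangentSpace 𝓘(ℝ, E) p) (V' : ∀ p : M', TangentSpace 𝓘(ℝ, F) p) :
      VectorField.mpullbackWithin 𝓘(ℝ, E × F) (𝓘(ℝ, E).prod 𝓘(ℝ, F))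
        (extChartAt (𝓘(ℝ, E).prod 𝓘(ℝ, F)) p).symm
        (prodField V V') (range (𝓘(ℝ, E).prod 𝓘(ℝ, F)))
        =ᶠ[𝓝 (extChartAt (𝓘(ℝ, E).prod 𝓘(ℝ, F)) p p)]
      fun z : E × F => ((VectorField.mpullbackWithin 𝓘(ℝ, E) 𝓘(ℝ, E) (extChartAt 𝓘(ℝ, E) p.1).symm V
        (range 𝓘(ℝ, E)) z.1, VectorField.mpullbackWithin 𝓘(ℝ, F) 𝓘(ℝ, F)
        (extChartAt 𝓘(ℝ, F) p.2).symm V' (range 𝓘(ℝ, F)) z.2) : E × F) := by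
    filter_upwards [extChartAt_target_mem_nhds (I := 𝓘(ℝ, E).prod 𝓘(ℝ, F)) p] with z hz
    rw [extChartAt_prod] at hz
    obtain ⟨h1, h2⟩ := hz
    have i1 := isInvertible_mfderivWithin_extChartAt_symm h1
    have i2 := isInvertible_mfderivWithin_extChartAt_symm h2
    have d1 := (contMDiffWithinAt_extChartAt_symm_range (n := 1) _ h1).mdifferentiableWithinAt one_ne_zero
    have d2 := (contMDiffWithinAt_extChartAt_symm_range (n := 1) _ h2).mdifferentiableWithinAt one_ne_zero
    simp only [ModelWithCorners.range_eq_univ, mdifferentiableWithinAt_univ, mfderivWithin_univ] at *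
    simp only [VectorField.mpullbackWithin_apply, mfderivWithin_univ]
    have e : ((extChartAt (𝓘(ℝ, E).prod 𝓘(ℝ, F)) p).symm : E × F → M × M') =
        fun y : E × F => ((extChartAt 𝓘(ℝ, E) p.1).symm y.1, (extChartAt 𝓘(ℝ, F) p.2).symm y.2) := by
      rw [extChartAt_prod]; rfl
    have k1 := d1.hasMFDerivAt.comp z (ContinuousLinearMap.fst ℝ E F).hasMFDerivAt
    have k2 := d2.hasMFDerivAt.comp z (ContinuousLinearMap.snd ℝ E F).hasMFDerivAt
    have key := (k1.prodMk k2).mfderiv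
    have e2 : mfderiv 𝓘(ℝ, E × F) (𝓘(ℝ, E).prod 𝓘(ℝ, F))
      (extChartAt (𝓘(ℝ, E).prod 𝓘(ℝ, F)) p).symm z =
      ((mfderiv 𝓘(ℝ, E) 𝓘(ℝ, E) (extChartAt 𝓘(ℝ, E) p.1).symm z.1 : E →L[ℝ] E).prodMap
        (mfderiv 𝓘(ℝ, F) 𝓘(ℝ, F) (extChartAt 𝓘(ℝ, F) p.2).symm z.2 : F →L[ℝ] F)) := by
      rw [e]
      exact key
    rw [e2]
    exact ContinuousLinearMap.IsInvertible.inverse_prodMap_apply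
      (E := E) (E' := E) (F := F) (F' := F) i1 i2 _
  have d1 := isInvertible_mfderiv_extChartAt (I := 𝓘(ℝ, E)) (mem_extChartAt_source p.1)
  have d2 := isInvertible_mfderiv_extChartAt (I := 𝓘(ℝ, F)) (mem_extChartAt_source p.2)
  have D1 := (contMDiffAt_extChartAt (I := 𝓘(ℝ, E)) (x := p.1) (n := 1)).mdifferentiableAt one_ne_zero
  have D2 := (contMDiffAt_extChartAt (I := 𝓘(ℝ, F)) (x := p.2) (n := 1)).mdifferentiableAt one_ne_zero
  have k1 := D1.hasMFDerivAt.comp p (hasMFDerivAt_fst (I := 𝓘(ℝ, E)) (I' := 𝓘(ℝ, F)) p)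
  have k2 := D2.hasMFDerivAt.comp p (hasMFDerivAt_snd (I := 𝓘(ℝ, E)) (I' := 𝓘(ℝ, F)) p)
  have key : mfderiv (𝓘(ℝ, E).prod 𝓘(ℝ, F)) 𝓘(ℝ, E × F) (extChartAt (𝓘(ℝ, E).prod 𝓘(ℝ, F)) p) p =
      ((mfderiv 𝓘(ℝ, E) 𝓘(ℝ, E) (extChartAt 𝓘(ℝ, E) p.1) p.1 : E →L[ℝ] E).prodMap
        (mfderiv 𝓘(ℝ, F) 𝓘(ℝ, F) (extChartAt 𝓘(ℝ, F) p.2) p.2 : F →L[ℝ] F)) := by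
    rw [extChartAt_prod]
    have k : HasMFDerivAt (𝓘(ℝ, E).prod 𝓘(ℝ, F)) 𝓘(ℝ, E × F)
        (fun q : M × M' => (extChartAt 𝓘(ℝ, E) p.1 q.1, extChartAt 𝓘(ℝ, F) p.2 q.2)) p
        ((mfderiv 𝓘(ℝ, E) 𝓘(ℝ, E) (extChartAt 𝓘(ℝ, E) p.1) p.1 : E →L[ℝ] E).prodMap
        (mfderiv 𝓘(ℝ, F) 𝓘(ℝ, F) (extChartAt 𝓘(ℝ, F) p.2) p.2 : F →L[ℝ] F)) :=
      ⟨k1.1.prodMk k2.1, k1.2.prodMk k2.2⟩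
    exact k.mfderiv
  have e0 : extChartAt (𝓘(ℝ, E).prod 𝓘(ℝ, F)) p p =
      (extChartAt 𝓘(ℝ, E) p.1 p.1, extChartAt 𝓘(ℝ, F) p.2 p.2) := by
    rw [extChartAt_prod]; rfl
  simp only [← VectorField.mlieBracketWithin_univ]
  simp only [← mdifferentiableWithinAt_univ] at hV hW hV' hW'
  have hVd := MDifferentiableWithinAt.differentiableWithinAt_mpullbackWithin_vectorField hV
  have hWd := MDifferentiableWithinAt.differentiableWithinAt_mpullbackWithin_vectorField hW
  have hVd' := MDifferentiableWithinAt.differentiableWithinAt_mpullbackWithin_vectorField hV'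
  have hWd' := MDifferentiableWithinAt.differentiableWithinAt_mpullbackWithin_vectorField hW'
  have pV := pull V V'
  have pW := pull W W'
  simp only [ModelWithCorners.range_eq_univ, preimage_univ, univ_inter] at *
  have main := VectorField.lieBracketWithin_univ_prod (z := extChartAt (𝓘(ℝ, E).prod 𝓘(ℝ, F)) p p)
    pV pW hVd hWd hVd' hWd'
  simp only [VectorField.mlieBracketWithin_apply, ModelWithCorners.range_eq_univ, preimage_univ,
    univ_inter]
  refine (congrArg (fun L : E × F →L[ℝ] E × F => L.inverse _) key).trans ?_
  refine (congrArg _ main).trans ?_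
  exact ContinuousLinearMap.IsInvertible.inverse_prodMap_apply
      (E := E) (E' := E) (F := F) (F' := F) d1 d2 _

end ProductBracket

/-! ### Families of smooth vector fields closed under brackets -/

section Fields

variable {F : Type*} [NormedAddCommGroup F] [NormedSpace ℝ F]
  {H : Type*} [TopologicalSpace H] {I : ModelWithCorners ℝ F H}
  {N : Type*} [TopologicalSpace N] [ChartedSpace H N]

section Smooth

variable [IsManifold I ∞ N]

theorem isManifold_one_of_infty : IsManifold I 1 N := .of_le (n := ∞) (by simp)
theorem isManifold_two_of_infty : IsManifold I 2 N := .of_le (n := ∞) (by norm_cast)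

theorem isSmoothField_zero (Ω : Set N) : IsSmoothField Ω (fun p : N => (0 : TangentSpace I p)) := by
  have := isManifold_one_of_infty (I := I) (N := N)
  exact (Bundle.contMDiff_zeroSection ℝ (TangentSpace I : N → Type _)).contMDiffOn

theorem IsSmoothField.add {Ω : Set N} {A B : ∀ p : N, TangentSpace I p}
    (hA : IsSmoothField Ω A) (hB : IsSmoothField Ω B) : IsSmoothField Ω (fun p => A p + B p) := by
  have := isManifold_one_of_infty (I := I) (N := N)
  exact ContMDiffOn.add_section hA hB

theorem IsSmoothField.smul {Ω : Set N} {φ : N → ℝ} {A : ∀ p : N, TangentSpace I p}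
    (hφ : ContMDiffOn I 𝓘(ℝ, ℝ) ∞ φ Ω) (hA : IsSmoothField Ω A) :
    IsSmoothField Ω (fun p => φ p • A p) := by
  have := isManifold_one_of_infty (I := I) (N := N)
  exact ContMDiffOn.smul_section hφ hA

theorem IsSmoothField.congr {Ω : Set N} {A B : ∀ p : N, TangentSpace I p}
    (hA : IsSmoothField Ω A) (h : ∀ p ∈ Ω, B p = A p) : IsSmoothField Ω B :=
  ContMDiffOn.congr hA fun p hp => by rw [h p hp]

theorem IsSmoothField.mdifferentiableAt {Ω : Set N} {A : ∀ p : N, TangentSpace I p}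
    (hA : IsSmoothField Ω A) (hΩ : IsOpen Ω) {p : N} (hp : p ∈ Ω) :
    MDifferentiableAt I I.tangent (fun p => (⟨p, A p⟩ : TangentBundle I N)) p :=
  (ContMDiffOn.contMDiffAt hA (hΩ.mem_nhds hp)).mdifferentiableAt (by simp)

theorem contMDiffOn_applyField {Ω : Set N} (hΩ : IsOpen Ω) {A : ∀ p : N, TangentSpace I p}
    (hA : IsSmoothField Ω A) {f : N → ℝ} (hf : ContMDiffOn I 𝓘(ℝ, ℝ) ∞ f Ω) :
    ContMDiffOn I 𝓘(ℝ, ℝ) ∞ (applyField A f) Ω := by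
  have := isManifold_one_of_infty (I := I) (N := N)
  have h1 := hf.contMDiffOn_tangentMapWithin (m := ∞) (by simp) hΩ.uniqueMDiffOn
  have h2 : ContMDiffOn I 𝓘(ℝ, ℝ).tangent ∞
      (fun p => tangentMapWithin I 𝓘(ℝ, ℝ) f Ω ⟨p, A p⟩) Ω := h1.comp hA fun p hp => hp
  have h3 := (contMDiff_snd_tangentBundle_modelSpace ℝ 𝓘(ℝ, ℝ)).comp_contMDiffOn h2
  refine h3.congr fun p hp => ?_
  change mfderiv I 𝓘(ℝ, ℝ) f p (A p) = mfderivWithin I 𝓘(ℝ, ℝ) f Ω p (A p)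
  rw [mfderivWithin_of_isOpen hΩ hp]

end Smooth

/-- The family of vector fields that agree on `Ω` with a member of the module over the smooth
functions on `Ω` generated by `𝒢`. -/
inductive ModuleSpan (Ω : Set N) (𝒢 : Set (∀ p : N, TangentSpace I p)) :
    (∀ p : N, TangentSpace I p) → Prop
  | of (A) : A ∈ 𝒢 → ModuleSpan Ω 𝒢 A
  | zero : ModuleSpan Ω 𝒢 (fun _ => 0)
  | add (A B) : ModuleSpan Ω 𝒢 A → ModuleSpan Ω 𝒢 B → ModuleSpan Ω 𝒢 (fun p => A p + B p)
  | smul (φ : N → ℝ) (A) : ContMDiffOn I 𝓘(ℝ, ℝ) ∞ φ Ω → ModuleSpan Ω 𝒢 A →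
      ModuleSpan Ω 𝒢 (fun p => φ p • A p)
  | congr (A B) : ModuleSpan Ω 𝒢 A → (∀ p ∈ Ω, B p = A p) → ModuleSpan Ω 𝒢 B

namespace ModuleSpan

variable {Ω : Set N} {𝒢 : Set (∀ p : N, TangentSpace I p)} {A B : ∀ p : N, TangentSpace I p}

theorem neg (hA : ModuleSpan Ω 𝒢 A) : ModuleSpan Ω 𝒢 (fun p => -A p) :=
  (smul (fun _ => -1) A contMDiffOn_const hA).congr _ _ fun p _ => by simp

theorem sum {ι : Type*} (s : Finset ι) {A : ι → ∀ p : N, TangentSpace I p}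
    (hA : ∀ i ∈ s, ModuleSpan Ω 𝒢 (A i)) : ModuleSpan Ω 𝒢 (fun p => ∑ i ∈ s, A i p) := by
  classical
  induction s using Finset.induction_on with
  | empty => simpa using zero
  | insert i s hi ih =>
    refine (add _ _ (hA i (by simp)) (ih fun j hj => hA j (by simp [hj]))).congr _ _ fun p _ => ?_
    rw [Finset.sum_insert hi]

variable [IsManifold I ∞ N]

theorem isSmoothField (h𝒢 : ∀ A ∈ 𝒢, IsSmoothField Ω A) (hA : ModuleSpan Ω 𝒢 A) :
    IsSmoothField Ω A := by
  induction hA with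
  | of A hA => exact h𝒢 A hA
  | zero => exact isSmoothField_zero Ω
  | add A B _ _ hA hB => exact hA.add hB
  | smul φ A hφ _ hA => exact hA.smul hφ
  | congr A B _ h hA => exact hA.congr h

variable [CompleteSpace F]

/-- If the brackets of `B` with the generators stay in the module, so do its brackets with all
members: `[B, φ A] = (B φ) A + φ [B, A]`. -/
theorem mlieBracket_of_generators (hΩ : IsOpen Ω) (h𝒢 : ∀ A ∈ 𝒢, IsSmoothField Ω A)
    (hB : IsSmoothField Ω B) (h : ∀ A ∈ 𝒢, ModuleSpan Ω 𝒢 (VectorField.mlieBracket I B A))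
    (hA : ModuleSpan Ω 𝒢 A) : ModuleSpan Ω 𝒢 (VectorField.mlieBracket I B A) := by
  have := isManifold_two_of_infty (I := I) (N := N)
  induction hA with
  | of A hA => exact h A hA
  | zero =>
    refine zero.congr _ _ fun p _ => ?_
    exact congrFun (VectorField.mlieBracket_zero_right (I := I) (W := B)) p
  | add A A' hA hA' ih ih' =>
    refine (add _ _ ih ih').congr _ _ fun p hp => ?_
    exact VectorField.mlieBracket_add_right ((hA.isSmoothField h𝒢).mdifferentiableAt hΩ hp)
      ((hA'.isSmoothField h𝒢).mdifferentiableAt hΩ hp)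
  | smul φ A hφ hA ih =>
    refine (add _ _ (smul _ _ (contMDiffOn_applyField hΩ hB hφ) hA) (smul _ _ hφ ih)).congr _ _
      fun p hp => ?_
    exact VectorField.mlieBracket_smul_right
      ((hφ.contMDiffAt (hΩ.mem_nhds hp)).mdifferentiableAt (by simp))
      ((hA.isSmoothField h𝒢).mdifferentiableAt hΩ hp)
  | congr A A' _ h ih =>
    refine ih.congr _ _ fun p hp => ?_
    refine Filter.EventuallyEq.mlieBracket_vectorField_eq .rfl ?_
    filter_upwards [hΩ.mem_nhds hp] with q hq using h q hq

/-- A module generated by fields whose mutual brackets belong to it is closed under brackets. -/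
theorem mlieBracket (hΩ : IsOpen Ω) (h𝒢 : ∀ A ∈ 𝒢, IsSmoothField Ω A)
    (h : ∀ A ∈ 𝒢, ∀ B ∈ 𝒢, ModuleSpan Ω 𝒢 (VectorField.mlieBracket I A B))
    (hA : ModuleSpan Ω 𝒢 A) (hB : ModuleSpan Ω 𝒢 B) :
    ModuleSpan Ω 𝒢 (VectorField.mlieBracket I A B) := by
  refine mlieBracket_of_generators hΩ h𝒢 (hA.isSmoothField h𝒢) (fun g hg => ?_) hB
  rw [VectorField.mlieBracket_swap]
  exact (mlieBracket_of_generators hΩ h𝒢 (h𝒢 g hg) (fun g' hg' => h g hg g' hg') hA).neg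

end ModuleSpan

/-- The vector fields that agree on `Ω` with a member of `ParabolicLieModule Ω X₀ X`. -/
def InParabolicModule (Ω : Set N) (X₀ : ∀ p : N, TangentSpace I p) {m : ℕ}
    (X : Fin m → ∀ p : N, TangentSpace I p) (A : ∀ p : N, TangentSpace I p) : Prop :=
  ∃ A', ParabolicLieModule Ω X₀ X A' ∧ ∀ p ∈ Ω, A p = A' p

namespace InParabolicModule

variable {Ω : Set N} {X₀ : ∀ p : N, TangentSpace I p} {m : ℕ}
  {X : Fin m → ∀ p : N, TangentSpace I p} {A B : ∀ p : N, TangentSpace I p}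

theorem congr (hA : InParabolicModule Ω X₀ X A) (h : ∀ p ∈ Ω, B p = A p) :
    InParabolicModule Ω X₀ X B := by
  obtain ⟨A', hA', e⟩ := hA
  exact ⟨A', hA', fun p hp => (h p hp).trans (e p hp)⟩

theorem field (j : Fin m) : InParabolicModule Ω X₀ X (X j) := ⟨_, .field j, fun _ _ => rfl⟩

theorem zero : InParabolicModule Ω X₀ X (fun _ => 0) := ⟨_, .zero, fun _ _ => rfl⟩

theorem add (hA : InParabolicModule Ω X₀ X A) (hB : InParabolicModule Ω X₀ X B) :
    InParabolicModule Ω X₀ X (fun p => A p + B p) := by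
  obtain ⟨A', hA', eA⟩ := hA
  obtain ⟨B', hB', eB⟩ := hB
  exact ⟨_, .add _ _ hA' hB', fun p hp => by simp only [eA p hp, eB p hp]⟩

theorem smul {φ : N → ℝ} (hφ : ContMDiffOn I 𝓘(ℝ, ℝ) ∞ φ Ω) (hA : InParabolicModule Ω X₀ X A) :
    InParabolicModule Ω X₀ X (fun p => φ p • A p) := by
  obtain ⟨A', hA', eA⟩ := hA
  exact ⟨_, .smul _ _ hφ hA', fun p hp => by simp only [eA p hp]⟩

theorem sum {ι : Type*} (s : Finset ι) {A : ι → ∀ p : N, TangentSpace I p}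
    (hA : ∀ i ∈ s, InParabolicModule Ω X₀ X (A i)) :
    InParabolicModule Ω X₀ X (fun p => ∑ i ∈ s, A i p) := by
  classical
  induction s using Finset.induction_on with
  | empty => simpa using zero
  | insert i s hi ih =>
    refine (add (hA i (by simp)) (ih fun j hj => hA j (by simp [hj]))).congr fun p _ => ?_
    rw [Finset.sum_insert hi]

theorem neg (hA : InParabolicModule Ω X₀ X A) : InParabolicModule Ω X₀ X (fun p => -A p) :=
  (hA.smul (φ := fun _ => -1) contMDiffOn_const).congr fun p _ => by simp

theorem lie (hΩ : IsOpen Ω) (hA : InParabolicModule Ω X₀ X A) (hB : InParabolicModule Ω X₀ X B) :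
    InParabolicModule Ω X₀ X (VectorField.mlieBracket I A B) := by
  obtain ⟨A', hA', eA⟩ := hA
  obtain ⟨B', hB', eB⟩ := hB
  refine ⟨_, .lie _ _ hA' hB', fun p hp => Filter.EventuallyEq.mlieBracket_vectorField_eq ?_ ?_⟩
  · filter_upwards [hΩ.mem_nhds hp] with q hq using eA q hq
  · filter_upwards [hΩ.mem_nhds hp] with q hq using eB q hq

theorem ad (hΩ : IsOpen Ω) (hA : InParabolicModule Ω X₀ X A) :
    InParabolicModule Ω X₀ X (VectorField.mlieBracket I X₀ A) := by
  obtain ⟨A', hA', eA⟩ := hA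
  refine ⟨_, .ad _ hA', fun p hp => Filter.EventuallyEq.mlieBracket_vectorField_eq .rfl ?_⟩
  filter_upwards [hΩ.mem_nhds hp] with q hq using eA q hq

end InParabolicModule

end Fields

/-! ### The left-invariant trivialization of the tangent bundle of `G × F` -/

/-- A linear system of coordinates on a subspace of a finite-dimensional space, with coordinate
functionals defined on the whole space. -/
theorem Submodule.exists_coordinates {V : Type*} [AddCommGroup V] [Module ℝ V]
    [FiniteDimensional ℝ V] (K : Submodule ℝ V) :
    ∃ (n : ℕ) (b : Fin n → V) (l : Fin n → Module.Dual ℝ V), (∀ i, b i ∈ K) ∧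
      (∀ i j, l i (b j) = if i = j then 1 else 0) ∧ ∀ w ∈ K, ∑ i, l i w • b i = w := by
  let β := Module.finBasis ℝ K
  choose l hl using fun i => LinearMap.exists_extend (β.coord i)
  have hl' : ∀ i (w : K), l i w = β.coord i w := fun i w => LinearMap.congr_fun (hl i) w
  refine ⟨_, fun i => β i, l, fun i => (β i).2, fun i j => ?_, fun w hw => ?_⟩
  · rw [hl']
    simp [Finsupp.single_apply, eq_comm]
  · have := congrArg (Subtype.val) (β.sum_repr ⟨w, hw⟩)
    rw [AddSubmonoidClass.coe_finsetSum] at this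
    refine Eq.trans (Finset.sum_congr rfl fun i _ => ?_) this
    rw [hl' i ⟨w, hw⟩]
    rfl

section Frame

variable {E : Type*} [NormedAddCommGroup E] [NormedSpace ℝ E]
  {G : Type*} [TopologicalSpace G] [ChartedSpace E G] [Group G]
  {F : Type*} [NormedAddCommGroup F] [NormedSpace ℝ F]

/-- Left translation trivializes the tangent bundle of `G × F`: the element `(w, y)` of `𝔤 × F` is
sent to the tangent vector at `(a, x)` whose components are the left translate of `w` to `a`, and
`y`. -/
def frameMap (p : G × F) :
    (LieAlgOf E G × F) →ₗ[ℝ] TangentSpace (𝓘(ℝ, E).prod 𝓘(ℝ, F)) p where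
  toFun z := ((mulInvariantVectorField z.1 p.1, z.2) : E × F)
  map_add' z z' := Prod.ext (congrFun (mulInvariantVectorField_add z.1 z'.1) p.1) rfl
  map_smul' r z := Prod.ext (congrFun (mulInvariantVectorField_smul r z.1) p.1) rfl

/-- The vector field on `G × F` with coefficients `W` and `c` in the left-invariant
trivialization. -/
def frameField (W : G × F → LieAlgOf E G) (c : G × F → F) (p : G × F) :
    TangentSpace (𝓘(ℝ, E).prod 𝓘(ℝ, F)) p :=
  frameMap p (W p, c p)

/-- The frame fields with constant coefficients, the one in `𝔤` being taken from `K`. -/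
def frameGenerators (K : Submodule ℝ (LieAlgOf E G)) :
    Set (∀ p : G × F, TangentSpace (𝓘(ℝ, E).prod 𝓘(ℝ, F)) p) :=
  {A | ∃ w ∈ K, ∃ y : F, A = frameField (fun _ => w) fun _ => y}

/-- The constant vector field on a vector space. -/
def constField (y : F) (x : F) : TangentSpace 𝓘(ℝ, F) x := y

theorem frameField_const_eq (w : LieAlgOf E G) (y : F) :
    frameField (fun _ => w) (fun _ => y) =
      prodField (M := G) (M' := F) (mulInvariantVectorField w) (constField y) := rfl

theorem contMDiff_constField (y : F) : ContMDiff 𝓘(ℝ, F) 𝓘(ℝ, F).tangent ∞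
    (fun x : F => (⟨x, constField y x⟩ : TangentBundle 𝓘(ℝ, F) F)) :=
  contMDiff_vectorSpace_iff_contDiff.2 (contDiff_const (c := y))

variable [FiniteDimensional ℝ E] [LieGroup 𝓘(ℝ, E) ∞ G]

theorem mfderiv_mul_left_injective (a : G) :
    Function.Injective (mfderiv 𝓘(ℝ, E) 𝓘(ℝ, E) (fun b : G => a * b) 1) := by
  have A : mfderiv 𝓘(ℝ, E) 𝓘(ℝ, E) ((fun x : G => a⁻¹ * x) ∘ fun x => a * x) (1 : G) =
      ContinuousLinearMap.id _ _ := by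
    have : ((fun x : G => a⁻¹ * x) ∘ fun x => a * x) = id := by ext x; simp
    rw [this, id_eq, mfderiv_id]
  rw [mfderiv_comp (I' := 𝓘(ℝ, E)) _
    ((contMDiff_mul_left (n := ∞)).contMDiffAt.mdifferentiableAt (by simp))
    ((contMDiff_mul_left (n := ∞)).contMDiffAt.mdifferentiableAt (by simp))] at A
  intro v w h
  have h1 := DFunLike.congr_fun A v
  have h2 := DFunLike.congr_fun A w
  exact h1.symm.trans ((congrArg (mfderiv 𝓘(ℝ, E) 𝓘(ℝ, E) (fun x : G => a⁻¹ * x) (a * 1)) h).trans h2)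

theorem frameMap_injective (p : G × F) : Function.Injective (frameMap (E := E) p) := by
  intro z z' h
  have h' : ((mulInvariantVectorField z.1 p.1, z.2) : E × F) =
    (mulInvariantVectorField z'.1 p.1, z'.2) := h
  exact Prod.ext (mfderiv_mul_left_injective p.1 (Prod.ext_iff.1 h').1) (Prod.ext_iff.1 h').2

variable [FiniteDimensional ℝ F]

theorem frameMap_surjective (p : G × F) : Function.Surjective (frameMap (E := E) p) := by
  have : FiniteDimensional ℝ (TangentSpace (𝓘(ℝ, E).prod 𝓘(ℝ, F)) p) :=
    inferInstanceAs (FiniteDimensional ℝ (E × F))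
  refine (LinearMap.injective_iff_surjective_of_finrank_eq_finrank ?_).1 (frameMap_injective p)
  exact (rfl : Module.finrank ℝ (E × F) = Module.finrank ℝ (E × F))

/-- The smooth version of `contMDiff_mulInvariantVectorField`. -/
theorem contMDiff_mulInvariantVectorField_infty (w : LieAlgOf E G) :
    ContMDiff 𝓘(ℝ, E) 𝓘(ℝ, E).tangent ∞
      (fun a : G => (⟨a, mulInvariantVectorField w a⟩ : TangentBundle 𝓘(ℝ, E) G)) := by
  have := isManifold_one_of_infty (I := 𝓘(ℝ, E)) (N := G)
  have h0 : ContMDiff 𝓘(ℝ, E) 𝓘(ℝ, E).tangent ∞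
      (fun a : G => (⟨a, 0⟩ : TangentBundle 𝓘(ℝ, E) G)) :=
    Bundle.contMDiff_zeroSection ℝ (TangentSpace 𝓘(ℝ, E) : G → Type _)
  have h1 : ContMDiff 𝓘(ℝ, E) 𝓘(ℝ, E).tangent ∞
      (fun _ : G => (⟨1, w⟩ : TangentBundle 𝓘(ℝ, E) G)) := contMDiff_const
  have h2 := (contMDiff_equivTangentBundleProd_symm (n := ∞) (I := 𝓘(ℝ, E)) (I' := 𝓘(ℝ, E))
    (M := G) (M' := G)).comp (h0.prodMk h1)
  have h3 := ((contMDiff_mul 𝓘(ℝ, E) ∞ (G := G)).contMDiff_tangentMap (m := ∞) (by simp)).comp h2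
  refine h3.congr fun a => ?_
  have e := mfderiv_prod_eq_add_apply (v := ((0, w) : E × E))
    (((contMDiff_mul 𝓘(ℝ, E) ∞ (G := G)).mdifferentiable (by simp)) (a, 1))
  have e0 : mfderiv 𝓘(ℝ, E) 𝓘(ℝ, E) (fun z : G => z * 1) a (0 : E) = 0 := map_zero _
  have e1 : mfderiv (𝓘(ℝ, E).prod 𝓘(ℝ, E)) 𝓘(ℝ, E) (fun p : G × G => p.1 * p.2) (a, 1)
      ((0, w) : E × E) = mulInvariantVectorField w a := by
    rw [e]
    dsimp only
    exact (congrArg (· + _) e0).trans (zero_add _)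
  exact Bundle.TotalSpace.ext (mul_one a).symm (heq_of_eq e1.symm)

theorem isSmoothField_frameField_const (Ω : Set (G × F)) (w : LieAlgOf E G) (y : F) :
    IsSmoothField Ω (frameField (G := G) (fun _ => w) fun _ => y) := by
  have := isManifold_one_of_infty (I := 𝓘(ℝ, E)) (N := G)
  have h3 := contMDiff_equivTangentBundleProd_symm (n := ∞) (I := 𝓘(ℝ, E)) (I' := 𝓘(ℝ, F))
    (M := G) (M' := F)
  exact (h3.comp ((contMDiff_mulInvariantVectorField_infty w).prodMap
    (contMDiff_constField y))).contMDiffOn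

theorem mlieBracket_frameField_const (w w' : LieAlgOf E G) (y y' : F) :
    VectorField.mlieBracket (𝓘(ℝ, E).prod 𝓘(ℝ, F)) (frameField (G := G) (fun _ => w) fun _ => y)
      (frameField (fun _ => w') fun _ => y') = frameField (fun _ => ⁅w, w'⁆) fun _ => 0 := by
  have := FiniteDimensional.complete ℝ E
  have := FiniteDimensional.complete ℝ F
  ext1 p
  rw [frameField_const_eq, frameField_const_eq, mlieBracket_prod
    (mdifferentiableAt_mulInvariantVectorField w) (mdifferentiableAt_mulInvariantVectorField w')
    ((contMDiff_constField y).mdifferentiable (by simp) _)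
    ((contMDiff_constField y').mdifferentiable (by simp) _)]
  have e : VectorField.mlieBracket 𝓘(ℝ, F) (constField y) (constField y') p.2 = 0 := by
    rw [← VectorField.mlieBracketWithin_univ, VectorField.mlieBracketWithin_eq_lieBracketWithin]
    exact (show VectorField.lieBracketWithin ℝ (fun _ : F => y) (fun _ => y') univ p.2 = 0 by
      simp [VectorField.lieBracket_eq])
  refine Prod.ext ?_ e
  exact congrFun (mulInvariantVector_mlieBracket w w').symm p.1

/-- A frame field with smooth coefficients, the one in `𝔤` having values in `K`, belongs to the
module generated by the constant frame fields with coefficients in `K`. -/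
theorem moduleSpan_frameField {Ω : Set (G × F)} {K : Submodule ℝ (LieAlgOf E G)}
    {W : G × F → LieAlgOf E G} {c : G × F → F}
    (hW : ∀ l : Module.Dual ℝ (LieAlgOf E G),
      ContMDiffOn (𝓘(ℝ, E).prod 𝓘(ℝ, F)) 𝓘(ℝ, ℝ) ∞ (fun p => l (W p)) Ω)
    (hWK : ∀ p ∈ Ω, W p ∈ K)
    (hc : ∀ l : Module.Dual ℝ F,
      ContMDiffOn (𝓘(ℝ, E).prod 𝓘(ℝ, F)) 𝓘(ℝ, ℝ) ∞ (fun p => l (c p)) Ω) :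
    ModuleSpan Ω (frameGenerators K) (frameField W c) := by
  obtain ⟨n, b, l, hb, -, hbl⟩ := K.exists_coordinates
  let β := Module.finBasis ℝ F
  have h1 := ModuleSpan.sum (Ω := Ω) (𝒢 := frameGenerators K) Finset.univ fun i _ =>
    ModuleSpan.smul (fun p => l i (W p)) _ (hW (l i))
      (.of (frameField (fun _ => b i) fun _ => (0 : F)) ⟨b i, hb i, 0, rfl⟩)
  have h2 := ModuleSpan.sum (Ω := Ω) (𝒢 := frameGenerators K) Finset.univ fun i _ =>
    ModuleSpan.smul (fun p => β.coord i (c p)) _ (hc (β.coord i))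
      (.of (frameField (fun _ => 0) fun _ => β i) ⟨0, K.zero_mem, β i, rfl⟩)
  refine (h1.add _ _ h2).congr _ _ fun p hp => ?_
  simp only [frameField, ← map_smul, ← map_sum, ← map_add]
  congr 1
  refine Prod.ext ?_ ?_
  · simp [Prod.fst_sum, hbl _ (hWK p hp)]
  · simp [Prod.snd_sum, β.sum_repr]

theorem isSmoothField_frameField {Ω : Set (G × F)}
    {W : G × F → LieAlgOf E G} {c : G × F → F}
    (hW : ∀ l : Module.Dual ℝ (LieAlgOf E G),
      ContMDiffOn (𝓘(ℝ, E).prod 𝓘(ℝ, F)) 𝓘(ℝ, ℝ) ∞ (fun p => l (W p)) Ω)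
    (hc : ∀ l : Module.Dual ℝ F,
      ContMDiffOn (𝓘(ℝ, E).prod 𝓘(ℝ, F)) 𝓘(ℝ, ℝ) ∞ (fun p => l (c p)) Ω) :
    IsSmoothField Ω (frameField W c) :=
  (moduleSpan_frameField (K := ⊤) hW (fun _ _ => trivial) hc).isSmoothField (by
    rintro _ ⟨w, -, y, rfl⟩
    exact isSmoothField_frameField_const Ω w y)

/-- The constant frame fields with coefficients in a Lie subalgebra generate an involutive
module. -/
theorem ModuleSpan.mlieBracket_frame {Ω : Set (G × F)} (hΩ : IsOpen Ω)
    {𝔥 : LieSubalgebra ℝ (LieAlgOf E G)}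
    {A B : ∀ p : G × F, TangentSpace (𝓘(ℝ, E).prod 𝓘(ℝ, F)) p}
    (hA : ModuleSpan Ω (frameGenerators 𝔥.toSubmodule) A)
    (hB : ModuleSpan Ω (frameGenerators 𝔥.toSubmodule) B) :
    ModuleSpan Ω (frameGenerators 𝔥.toSubmodule)
      (VectorField.mlieBracket (𝓘(ℝ, E).prod 𝓘(ℝ, F)) A B) := by
  have := FiniteDimensional.complete ℝ E
  have := FiniteDimensional.complete ℝ F
  refine ModuleSpan.mlieBracket hΩ ?_ ?_ hA hB
  · rintro _ ⟨w, -, y, rfl⟩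
    exact isSmoothField_frameField_const Ω w y
  · rintro _ ⟨w, hw, y, rfl⟩ _ ⟨w', hw', y', rfl⟩
    rw [mlieBracket_frameField_const]
    exact .of _ ⟨_, 𝔥.lie_mem hw hw', _, rfl⟩

/-- If `K` is stable under `ad s`, then the module generated by the constant frame fields with
coefficients in `K` is stable under the bracket with the left-invariant field of `s`. -/
theorem ModuleSpan.mlieBracket_frame_left {Ω : Set (G × F)} (hΩ : IsOpen Ω)
    {K : Submodule ℝ (LieAlgOf E G)} {s : LieAlgOf E G} (hs : ∀ w ∈ K, ⁅s, w⁆ ∈ K)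
    {A : ∀ p : G × F, TangentSpace (𝓘(ℝ, E).prod 𝓘(ℝ, F)) p}
    (hA : ModuleSpan Ω (frameGenerators K) A) :
    ModuleSpan Ω (frameGenerators K)
      (VectorField.mlieBracket (𝓘(ℝ, E).prod 𝓘(ℝ, F)) (frameField (fun _ => s) fun _ => 0) A) := by
  have := FiniteDimensional.complete ℝ E
  have := FiniteDimensional.complete ℝ F
  refine ModuleSpan.mlieBracket_of_generators hΩ ?_ (isSmoothField_frameField_const Ω s 0) ?_ hA
  · rintro _ ⟨w, -, y, rfl⟩
    exact isSmoothField_frameField_const Ω w y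
  · rintro _ ⟨w, hw, y, rfl⟩
    rw [mlieBracket_frameField_const]
    exact .of _ ⟨_, hs w hw, _, rfl⟩

/-- Membership in the module constrains the value at each point: the invertibility of `frameMap`
then recovers the `𝔤`-component of the value as an element of `K`. -/
theorem ModuleSpan.exists_eq_frameMap {Ω : Set (G × F)} {K : Submodule ℝ (LieAlgOf E G)}
    {A : ∀ p : G × F, TangentSpace (𝓘(ℝ, E).prod 𝓘(ℝ, F)) p}
    (hA : ModuleSpan Ω (frameGenerators K) A) {p : G × F} (hp : p ∈ Ω) :
    ∃ w ∈ K, ∃ y, A p = frameMap p (w, y) := by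
  induction hA with
  | of A hA =>
    obtain ⟨w, hw, y, rfl⟩ := hA
    exact ⟨w, hw, y, rfl⟩
  | zero => exact ⟨0, K.zero_mem, 0, (map_zero (frameMap p)).symm⟩
  | add A B _ _ hA hB =>
    obtain ⟨w, hw, y, e⟩ := hA
    obtain ⟨w', hw', y', e'⟩ := hB
    exact ⟨w + w', K.add_mem hw hw', y + y', by
      simp only [e, e', ← map_add, Prod.mk_add_mk]⟩
  | smul φ A _ _ hA =>
    obtain ⟨w, hw, y, e⟩ := hA
    exact ⟨φ p • w, K.smul_mem _ hw, φ p • y, by simp only [e, ← map_smul, Prod.smul_mk]⟩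
  | congr A B _ h hA => rwa [h p hp]

end Frame

/-! ### Necessity of the p-hull condition -/

section ApplyField

variable {F : Type*} [NormedAddCommGroup F] [NormedSpace ℝ F]
  {H : Type*} [TopologicalSpace H] {I : ModelWithCorners ℝ F H}
  {N : Type*} [TopologicalSpace N] [ChartedSpace H N]

theorem applyField_mul {X : ∀ p : N, TangentSpace I p} {f g : N → ℝ} {p : N}
    (hf : MDifferentiableAt I 𝓘(ℝ, ℝ) f p) (hg : MDifferentiableAt I 𝓘(ℝ, ℝ) g p) :
    applyField X (fun q => f q * g q) p = f p * applyField X g p + g p * applyField X f p := by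
  have h := (hf.hasMFDerivAt.mul hg.hasMFDerivAt).mfderiv
  exact DFunLike.congr_fun h (X p)

theorem applyField_congr {X : ∀ p : N, TangentSpace I p} {f g : N → ℝ} {p : N}
    (h : f =ᶠ[𝓝 p] g) : applyField X f p = applyField X g p :=
  DFunLike.congr_fun h.mfderiv_eq (X p)

theorem applyField_zero (X : ∀ p : N, TangentSpace I p) (p : N) :
    applyField X (fun _ => 0) p = 0 := by
  have := DFunLike.congr_fun (mfderiv_const (I := I) (I' := 𝓘(ℝ, ℝ)) (c := (0 : ℝ)) (x := p)) (X p)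
  exact this

end ApplyField

section PHull

variable {E : Type*} [NormedAddCommGroup E] [NormedSpace ℝ E] [FiniteDimensional ℝ E]
  {G : Type*} [TopologicalSpace G] [ChartedSpace E G] [Group G] [LieGroup 𝓘(ℝ, E) ∞ G]

theorem pHull_le {S : Set (LieAlgOf E G)} {𝔥 : LieSubalgebra ℝ (LieAlgOf E G)}
    (h₁ : ∀ s₁ ∈ S, ∀ s₂ ∈ S, s₁ - s₂ ∈ 𝔥) (h₂ : ∀ s ∈ S, ∀ z ∈ 𝔥, ⁅s, z⁆ ∈ 𝔥) :
    pHull S ≤ 𝔥 :=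
  sInf_le (α := LieSubalgebra ℝ (LieAlgOf E G)) ⟨h₁, h₂⟩

theorem mem_pHull {S : Set (LieAlgOf E G)} {z : LieAlgOf E G} :
    z ∈ pHull S ↔ ∀ 𝔥 : LieSubalgebra ℝ (LieAlgOf E G), (∀ s₁ ∈ S, ∀ s₂ ∈ S, s₁ - s₂ ∈ 𝔥) →
      (∀ s ∈ S, ∀ z ∈ 𝔥, ⁅s, z⁆ ∈ 𝔥) → z ∈ 𝔥 := by
  rw [← SetLike.mem_coe, pHull, LieSubalgebra.coe_sInf]
  simp

theorem sub_mem_pHull {S : Set (LieAlgOf E G)} {s₁ s₂ : LieAlgOf E G} (h₁ : s₁ ∈ S) (h₂ : s₂ ∈ S) :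
    s₁ - s₂ ∈ pHull S :=
  mem_pHull.2 fun _ h _ => h _ h₁ _ h₂

theorem lie_mem_pHull {S : Set (LieAlgOf E G)} {s z : LieAlgOf E G} (hs : s ∈ S)
    (hz : z ∈ pHull S) : ⁅s, z⁆ ∈ pHull S :=
  mem_pHull.2 fun 𝔥 h h' => h' _ hs _ (mem_pHull.1 hz 𝔥 h h')

end PHull

section Necessity

variable {E : Type*} [NormedAddCommGroup E] [NormedSpace ℝ E] [FiniteDimensional ℝ E]
  {G : Type*} [TopologicalSpace G] [ChartedSpace E G] [Group G] [LieGroup 𝓘(ℝ, E) ∞ G]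

theorem t2Space_of_lieGroup (E : Type*) [NormedAddCommGroup E] [NormedSpace ℝ E] (G : Type*)
    [TopologicalSpace G] [ChartedSpace E G] [Group G] [LieGroup 𝓘(ℝ, E) ∞ G] : T2Space G := by
  have := topologicalGroup_of_lieGroup 𝓘(ℝ, E) ∞ (G := G)
  have := ChartedSpace.t1Space E G
  infer_instance

/-- Smooth functions on the group separate tangent vectors. -/
theorem eq_of_forall_mfderiv_eq {a : G} {ξ η : TangentSpace 𝓘(ℝ, E) a}
    (h : ∀ f : G → ℝ, ContMDiff 𝓘(ℝ, E) 𝓘(ℝ, ℝ) ∞ f →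
      mvfderiv 𝓘(ℝ, E) f a ξ = mvfderiv 𝓘(ℝ, E) f a η) : ξ = η := by
  have := t2Space_of_lieGroup E G
  have := isManifold_one_of_infty (I := 𝓘(ℝ, E)) (N := G)
  have b : SmoothBumpFunction 𝓘(ℝ, E) a := Classical.choice inferInstance
  have inv := isInvertible_mfderiv_extChartAt (I := 𝓘(ℝ, E)) (mem_extChartAt_source a)
  have inj : Function.Injective (mfderiv 𝓘(ℝ, E) 𝓘(ℝ, E) (extChartAt 𝓘(ℝ, E) a) a) := by
    obtain ⟨e, he⟩ := inv
    rw [← he]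
    exact e.injective
  refine inj ?_
  have hd := (contMDiffAt_extChartAt (I := 𝓘(ℝ, E)) (x := a) (n := 1)).mdifferentiableAt one_ne_zero
  have key (l : StrongDual ℝ E) (ζ : TangentSpace 𝓘(ℝ, E) a) :
      mfderiv 𝓘(ℝ, E) 𝓘(ℝ, ℝ) (fun x => b x • l (extChartAt 𝓘(ℝ, E) a x)) a ζ =
        l (mfderiv 𝓘(ℝ, E) 𝓘(ℝ, E) (extChartAt 𝓘(ℝ, E) a) a ζ) := by
    have h1 : (fun x => b x • l (extChartAt 𝓘(ℝ, E) a x)) =ᶠ[𝓝 a]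
        l ∘ extChartAt 𝓘(ℝ, E) a := by
      filter_upwards [b.eventuallyEq_one] with x hx
      simp [hx]
    rw [h1.mfderiv_eq]
    exact DFunLike.congr_fun (l.hasMFDerivAt.comp a hd.hasMFDerivAt).mfderiv ζ
  refine (SeparatingDual.eq_iff_forall_dual_eq (R := ℝ) (V := E)).2 fun l => ?_
  refine (key l ξ).symm.trans (Eq.trans ?_ (key l η))
  refine h _ (b.contMDiff_smul ?_)
  exact l.contMDiff.comp_contMDiffOn contMDiffOn_extChartAt

variable {d : ℕ} {W : Type*} [AddCommGroup W] [Module ℝ W] [TopologicalSpace W]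
  {gW : MetricTensor W} {ρ : W → ℝ} {v : W → LieAlgOf E G} {B : W → W} {ε : ℝ}
  {ψ : EuclideanSpace ℝ (Fin d) → W}

/-- On functions that depend on the group variable only, the Fokker-Planck operator is the
derivative along the velocity. -/
theorem fokkerPlanck_comp_fst (f : G → ℝ) (t : ℝ) (p : G × EuclideanSpace ℝ (Fin d)) :
    fokkerPlanck gW ρ v B ε ψ (fun q => f q.2.1) (t, p) =
      mvfderiv 𝓘(ℝ, E) f p.1 (mulInvariantVectorField (v (ψ p.2)) p.1) := by
  obtain ⟨a, x⟩ := p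
  have h (i : Fin d) (c : ℝ) (x : EuclideanSpace ℝ (Fin d)) :
      partialDeriv i (fun _ => c) x = 0 := by
    simp [partialDeriv]
  simp [fokkerPlanck, applyField, laplaceBeltrami, h]
  exact zero_add _

variable {Ω : Set (G × EuclideanSpace ℝ (Fin d))}
  {X₀ : ∀ p : G × EuclideanSpace ℝ (Fin d),
    TangentSpace (𝓘(ℝ, E).prod 𝓘(ℝ, EuclideanSpace ℝ (Fin d))) p} {m : ℕ}
  {X : Fin m → ∀ p : G × EuclideanSpace ℝ (Fin d),
    TangentSpace (𝓘(ℝ, E).prod 𝓘(ℝ, EuclideanSpace ℝ (Fin d))) p}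

theorem applyField_comp_fst (Y : ∀ p : G × EuclideanSpace ℝ (Fin d),
    TangentSpace (𝓘(ℝ, E).prod 𝓘(ℝ, EuclideanSpace ℝ (Fin d))) p) {f : G → ℝ}
    (hf : ContMDiff 𝓘(ℝ, E) 𝓘(ℝ, ℝ) ∞ f) (p : G × EuclideanSpace ℝ (Fin d)) :
    applyField Y (fun q => f q.1) p = mvfderiv 𝓘(ℝ, E) f p.1 (Y p).1 :=
  DFunLike.congr_fun ((hf.mdifferentiable (by simp) p.1).hasMFDerivAt.comp p
    (hasMFDerivAt_fst (I := 𝓘(ℝ, E)) (I' := 𝓘(ℝ, EuclideanSpace ℝ (Fin d))) p)).mfderiv (Y p)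

/-- Both sides of the representation as a sum of squares, applied to a function of the group variable
only. -/
theorem IsSumOfSquares.apply_comp_fst
    (h : IsSumOfSquares (𝓘(ℝ, E).prod 𝓘(ℝ, EuclideanSpace ℝ (Fin d)))
      (fokkerPlanck (G := G) gW ρ v B ε ψ) Ω X₀ X)
    {f : G → ℝ} (hf : ContMDiff 𝓘(ℝ, E) 𝓘(ℝ, ℝ) ∞ f) {p : G × EuclideanSpace ℝ (Fin d)}
    (hp : p ∈ Ω) :
    mvfderiv 𝓘(ℝ, E) f p.1 (mulInvariantVectorField (v (ψ p.2)) p.1) =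
      mvfderiv 𝓘(ℝ, E) f p.1 (X₀ p).1
        - ∑ j, applyField (X j) (applyField (X j) fun q => f q.1) p := by
  have e := h.eq (fun q => f q.2.1)
    (hf.comp (contMDiff_fst.comp contMDiff_snd)).contMDiffOn 0 p hp
  rw [fokkerPlanck_comp_fst] at e
  refine e.trans (congrArg (· - _) ?_)
  have e0 : deriv (fun _ : ℝ => f p.1) 0 = 0 := deriv_const _ _
  exact (congrArg (· + _) e0).trans ((zero_add _).trans (applyField_comp_fst X₀ hf p))

/-- Comparing the terms of second order: the fields `X_j` have no component along the group. -/
theorem IsSumOfSquares.fst_eq_zero (hΩ : IsOpen Ω)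
    (h : IsSumOfSquares (𝓘(ℝ, E).prod 𝓘(ℝ, EuclideanSpace ℝ (Fin d)))
      (fokkerPlanck (G := G) gW ρ v B ε ψ) Ω X₀ X)
    {p : G × EuclideanSpace ℝ (Fin d)} (hp : p ∈ Ω) (j : Fin m) : (X j p).1 = (0 : E) := by
  refine eq_of_forall_mfderiv_eq (a := p.1) (η := 0) fun f₀ hf₀ => ?_
  -- for `f` vanishing at `p`, `X_i² f² = 2 (X_i f)²` at `p`, and the operator annihilates `f²` there
  let f : G → ℝ := fun a => f₀ a - f₀ p.1
  have hf : ContMDiff 𝓘(ℝ, E) 𝓘(ℝ, ℝ) ∞ f := hf₀.sub contMDiff_const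
  have hf2 : ContMDiff 𝓘(ℝ, E) 𝓘(ℝ, ℝ) ∞ fun a => f a * f a := hf.mul hf
  have fp : f p.1 = 0 := sub_self _
  have hfst : ContMDiff (𝓘(ℝ, E).prod 𝓘(ℝ, EuclideanSpace ℝ (Fin d))) 𝓘(ℝ, ℝ) ∞
    (fun q : G × EuclideanSpace ℝ (Fin d) => f q.1) := hf.comp contMDiff_fst
  have sq (ζ : TangentSpace 𝓘(ℝ, E) p.1) :
      mvfderiv 𝓘(ℝ, E) (fun a => f a * f a) p.1 ζ = 0 := by
    have := (hf.mdifferentiable (by simp) p.1).hasMFDerivAt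
    have e : mvfderiv 𝓘(ℝ, E) (fun a => f a * f a) p.1 ζ =
        f p.1 * mvfderiv 𝓘(ℝ, E) f p.1 ζ + f p.1 * mvfderiv 𝓘(ℝ, E) f p.1 ζ :=
      DFunLike.congr_fun (this.mul this).mfderiv ζ
    rw [e, fp]
    ring
  have Y (i : Fin m) : applyField (X i) (applyField (X i) fun q => f q.1 * f q.1) p =
      2 * (applyField (X i) (fun q => f q.1) p) ^ 2 := by
    have hY := contMDiffOn_applyField hΩ (h.smooth i) hfst.contMDiffOn
    have e : applyField (X i) (fun q => f q.1 * f q.1) =ᶠ[𝓝 p]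
        fun q => (2 * f q.1) * applyField (X i) (fun q => f q.1) q := by
      filter_upwards with q
      rw [applyField_mul (hfst.mdifferentiable (by simp) q) (hfst.mdifferentiable (by simp) q)]
      ring
    have hd := (hfst.mdifferentiable (by simp) p)
    rw [applyField_congr e, applyField_mul (f := fun q => 2 * f q.1)
      ((mdifferentiableAt_const (c := (2 : ℝ))).mul hd)
      ((hY.contMDiffAt (hΩ.mem_nhds hp)).mdifferentiableAt (by simp)),
      applyField_mul (f := fun _ => 2) mdifferentiableAt_const hd, fp]
    ring
  have e := h.apply_comp_fst hf2 hp
  simp only [sq, Y] at e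
  have e0 : 0 = 0 - ∑ i, 2 * (applyField (X i) (fun q => f q.1) p) ^ 2 :=
    e.trans (congrArg (· - _) (sq (X₀ p).1))
  have e' : ∑ i, 2 * (applyField (X i) (fun q => f q.1) p) ^ 2 = 0 := by linarith
  rw [Finset.sum_eq_zero_iff_of_nonneg fun i _ => by positivity] at e'
  have e2 : applyField (X j) (fun q => f q.1) p = 0 := by simpa using e' j (Finset.mem_univ j)
  have e3 : mvfderiv 𝓘(ℝ, E) f p.1 (X j p).1 = 0 := (applyField_comp_fst _ hf p).symm.trans e2
  have e4 : mvfderiv 𝓘(ℝ, E) f p.1 (X j p).1 =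
      mvfderiv 𝓘(ℝ, E) f₀ p.1 (X j p).1 - (0 : E →L[ℝ] ℝ) (X j p).1 :=
    DFunLike.congr_fun ((hf₀.mdifferentiable (by simp) p.1).hasMFDerivAt.sub
      (hasMFDerivAt_const (f₀ p.1) p.1)).mfderiv (X j p).1
  exact ((sub_zero _).symm.trans (e4.symm.trans e3)).trans (map_zero _).symm

/-- Comparing the terms of first order: the component of `X_0` along the group is the velocity. -/
theorem IsSumOfSquares.fst_eq_velocity (hΩ : IsOpen Ω)
    (h : IsSumOfSquares (𝓘(ℝ, E).prod 𝓘(ℝ, EuclideanSpace ℝ (Fin d)))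
      (fokkerPlanck (G := G) gW ρ v B ε ψ) Ω X₀ X)
    {p : G × EuclideanSpace ℝ (Fin d)} (hp : p ∈ Ω) :
    (X₀ p).1 = mulInvariantVectorField (v (ψ p.2)) p.1 := by
  refine eq_of_forall_mfderiv_eq (a := p.1) fun f hf => ?_
  rw [h.apply_comp_fst hf hp, Finset.sum_eq_zero fun j _ => ?_]
  · exact (sub_zero _).symm
  have e : applyField (X j) (fun q => f q.1) =ᶠ[𝓝 p] fun _ => 0 := by
    filter_upwards [hΩ.mem_nhds hp] with q hq
    rw [applyField_comp_fst _ hf]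
    exact (congrArg _ (h.fst_eq_zero hΩ hq j)).trans (map_zero _)
  rw [applyField_congr e, applyField_zero]

/-- If the Fokker-Planck operator satisfies the parabolic Hörmander condition near one point, then
the p-hull `𝔥` of the set of velocities is the whole Lie algebra: near that point the fields `X_j`,
and the field `X_0` up to a left-invariant field `e_s` with `s` a velocity, have their components
along the group in `𝔥`, so this holds for the entire parabolic Lie module. -/
theorem pHull_eq_top_of_parabolicHormander {U : Set (EuclideanSpace ℝ (Fin d))} {S : Set W}
    (hψ : MapsTo ψ U S) (hv : ∀ l : Module.Dual ℝ (LieAlgOf E G),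
      ContDiffOn ℝ ∞ (fun x => l (v (ψ x))) U)
    {x₀ : EuclideanSpace ℝ (Fin d)} (hx₀ : x₀ ∈ U)
    (h : ParabolicHormander (𝓘(ℝ, E).prod 𝓘(ℝ, EuclideanSpace ℝ (Fin d)))
      (fokkerPlanck (G := G) gW ρ v B ε ψ) ((univ : Set G) ×ˢ U)) :
    pHull (v '' S) = ⊤ := by
  obtain ⟨Ω, hΩ, hp, hΩU, m, X₀, X, hP, hfull⟩ := h (1, x₀) ⟨mem_univ _, hx₀⟩
  set 𝔥 := pHull (v '' S) with h𝔥
  have := FiniteDimensional.complete ℝ E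
  have mem {p : G × EuclideanSpace ℝ (Fin d)} (hp : p ∈ Ω) : v (ψ p.2) ∈ v '' S :=
    mem_image_of_mem v (hψ (hΩU hp).2)
  have hs₀ := mem hp
  have smooth_snd {Y : ∀ p : G × EuclideanSpace ℝ (Fin d),
      TangentSpace (𝓘(ℝ, E).prod 𝓘(ℝ, EuclideanSpace ℝ (Fin d))) p} (hY : IsSmoothField Ω Y)
      (l : Module.Dual ℝ (EuclideanSpace ℝ (Fin d))) :
      ContMDiffOn (𝓘(ℝ, E).prod 𝓘(ℝ, EuclideanSpace ℝ (Fin d))) 𝓘(ℝ, ℝ) ∞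
        (fun p => l (Y p).2) Ω := by
    have hl : ContMDiff 𝓘(ℝ, EuclideanSpace ℝ (Fin d)) 𝓘(ℝ, ℝ) ∞ l.toContinuousLinearMap :=
      l.toContinuousLinearMap.contMDiff
    refine (contMDiffOn_applyField hΩ hY (hl.comp contMDiff_snd).contMDiffOn).congr fun p _ => ?_
    exact (DFunLike.congr_fun (l.toContinuousLinearMap.hasMFDerivAt.comp p
      (hasMFDerivAt_snd (I := 𝓘(ℝ, E)) (I' := 𝓘(ℝ, EuclideanSpace ℝ (Fin d))) p)).mfderiv
        (Y p)).symm
  have hX (j : Fin m) : ModuleSpan Ω (frameGenerators 𝔥.toSubmodule) (X j) := by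
    refine (moduleSpan_frameField (W := fun _ => 0) (c := fun p => (X j p).2)
      (fun l => contMDiffOn_const) (fun _ _ => 𝔥.zero_mem) (smooth_snd (hP.smooth j))).congr _ _
      fun p hp => ?_
    refine Prod.ext ((hP.fst_eq_zero hΩ hp j).trans ?_) rfl
    exact (map_zero (mfderiv 𝓘(ℝ, E) 𝓘(ℝ, E) (fun b => p.1 * b) 1)).symm
  -- `X_0 = e_s + Q` with `s` the velocity at `x₀` and `Q` in the module generated over `𝔥`
  let Q := frameField (fun p : G × EuclideanSpace ℝ (Fin d) => v (ψ p.2) - v (ψ x₀))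
    (fun p => (X₀ p).2)
  have hQ : ModuleSpan Ω (frameGenerators 𝔥.toSubmodule) Q := by
    refine moduleSpan_frameField (fun l => ?_) (fun p hp => sub_mem_pHull (mem hp) hs₀)
      (smooth_snd hP.smooth_zero)
    simp only [map_sub]
    refine ContMDiffOn.sub ?_ contMDiffOn_const
    exact (hv l).contMDiffOn.comp contMDiff_snd.contMDiffOn fun p hp => (hΩU hp).2
  have gens : ∀ A ∈ frameGenerators (G := G) (F := EuclideanSpace ℝ (Fin d)) 𝔥.toSubmodule,
      IsSmoothField Ω A := by
    rintro _ ⟨w, -, y, rfl⟩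
    exact isSmoothField_frameField_const Ω w y
  have hX₀ : ∀ p ∈ Ω, X₀ p = frameField (fun _ => v (ψ x₀)) (fun _ => 0) p + Q p := by
    intro p hp
    simp only [Q, frameField, ← map_add, Prod.mk_add_mk]
    refine Prod.ext ((hP.fst_eq_velocity hΩ hp).trans ?_) ?_
    · rw [add_sub_cancel]
      rfl
    · exact (zero_add _).symm
  have main : ∀ A, ParabolicLieModule Ω X₀ X A →
      ModuleSpan Ω (frameGenerators 𝔥.toSubmodule) A := by
    intro A hA
    induction hA with
    | field j => exact hX j
    | zero => exact .zero
    | add A B _ _ hA hB => exact .add _ _ hA hB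
    | smul φ A hφ _ hA => exact .smul _ _ hφ hA
    | lie A B _ _ hA hB => exact hA.mlieBracket_frame hΩ hB
    | ad A _ hA =>
      refine ((hA.mlieBracket_frame_left hΩ fun w hw => lie_mem_pHull hs₀ hw).add _ _
        (hQ.mlieBracket_frame hΩ hA)).congr _ _ fun p hp => ?_
      have h2 := isManifold_two_of_infty (I := 𝓘(ℝ, E).prod 𝓘(ℝ, EuclideanSpace ℝ (Fin d)))
        (N := G × EuclideanSpace ℝ (Fin d))
      rw [Filter.EventuallyEq.mlieBracket_vectorField_eq (W₁ := A) (W := A)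
        (Filter.eventually_of_mem (hΩ.mem_nhds hp) hX₀) .rfl]
      exact VectorField.mlieBracket_add_left
        ((isSmoothField_frameField_const Ω _ _).mdifferentiableAt hΩ hp)
        ((hQ.isSmoothField gens).mdifferentiableAt hΩ hp)
  refine eq_top_iff.2 fun w _ => ?_
  obtain ⟨A, hA, e⟩ := hfull (frameMap (1, x₀) (w, 0))
  obtain ⟨w', hw', y, e'⟩ := (main A hA).exists_eq_frameMap hp
  have := frameMap_injective (E := E) ((1 : G), x₀) (e.symm.trans e')
  rwa [show w = w' from (Prod.ext_iff.1 this).1]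

end Necessity

/-! ### Smooth maps into a finite-dimensional space and their directional derivatives -/

section SmoothInto

variable {F : Type*} [NormedAddCommGroup F] [NormedSpace ℝ F]
  {V : Type*} [AddCommGroup V] [Module ℝ V]

/-- A map into a finite-dimensional vector space, which need not carry a norm, is smooth on `U`: its
compositions with linear functionals are. -/
def IsSmoothInto (U : Set F) (f : F → V) : Prop :=
  ∀ l : Module.Dual ℝ V, ContDiffOn ℝ ∞ (fun x => l (f x)) U

theorem IsSmoothInto.mono {U U' : Set F} {f : F → V} (hf : IsSmoothInto U f) (h : U' ⊆ U) :
    IsSmoothInto U' f := fun l => (hf l).mono h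

theorem isSmoothInto_const (U : Set F) (w : V) : IsSmoothInto U fun _ => w :=
  fun _ => contDiffOn_const

theorem IsSmoothInto.add {U : Set F} {f g : F → V} (hf : IsSmoothInto U f)
    (hg : IsSmoothInto U g) : IsSmoothInto U fun x => f x + g x := fun l => by
  simp only [map_add]
  exact (hf l).add (hg l)

theorem IsSmoothInto.const_smul {U : Set F} {f : F → V} (hf : IsSmoothInto U f) (r : ℝ) :
    IsSmoothInto U fun x => r • f x := fun l => by
  simp only [map_smul]
  exact (hf l).const_smul r

theorem ContDiffOn.isSmoothInto {F' : Type*} [NormedAddCommGroup F'] [NormedSpace ℝ F']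
    [FiniteDimensional ℝ F'] {U : Set F} {f : F → F'} (hf : ContDiffOn ℝ ∞ f U) :
    IsSmoothInto U f :=
  fun l => l.toContinuousLinearMap.contDiff.comp_contDiffOn hf

variable [FiniteDimensional ℝ V]

/-- The derivative of `f` in the direction `y`, computed in a basis of the target, as the target need
not carry a norm. -/
def dirDeriv (y : F) (f : F → V) (x : F) : V :=
  ∑ i, fderiv ℝ (fun x => (Module.finBasis ℝ V).coord i (f x)) x y • Module.finBasis ℝ V i

theorem dual_dirDeriv {U : Set F} (hU : IsOpen U) {f : F → V} (hf : IsSmoothInto U f) (y : F)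
    (l : Module.Dual ℝ V) {x : F} (hx : x ∈ U) :
    l (dirDeriv y f x) = fderiv ℝ (fun x => l (f x)) x y := by
  have hd (l : Module.Dual ℝ V) : DifferentiableAt ℝ (fun x => l (f x)) x :=
    ((hf l).contDiffAt (hU.mem_nhds hx)).differentiableAt (by simp)
  have e : (fun x => l (f x)) = fun x =>
      ∑ i, l (Module.finBasis ℝ V i) * (Module.finBasis ℝ V).coord i (f x) := by
    ext x
    conv_lhs => rw [← (Module.finBasis ℝ V).sum_repr (f x)]
    rw [map_sum]
    exact Finset.sum_congr rfl fun i _ => by simp [mul_comm]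
  rw [e, fderiv_fun_sum fun i _ => (hd _).const_mul _]
  simp only [dirDeriv, map_sum, map_smul, sum_apply, smul_eq_mul]
  refine Finset.sum_congr rfl fun i _ => ?_
  rw [fderiv_const_mul (hd _)]
  exact mul_comm _ _

theorem IsSmoothInto.dirDeriv {U : Set F} (hU : IsOpen U) {f : F → V} (hf : IsSmoothInto U f)
    (y : F) : IsSmoothInto U (dirDeriv y f) := fun l => by
  refine ContDiffOn.congr ?_ fun x hx => dual_dirDeriv hU hf y l hx
  exact ((hf l).fderiv_of_isOpen hU (by simp)).clm_apply contDiffOn_const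

/-- A subspace of a finite-dimensional space is the intersection of the kernels containing it. -/
theorem mem_of_forall_dual {K : Submodule ℝ V} {w : V}
    (h : ∀ l : Module.Dual ℝ V, (∀ z ∈ K, l z = 0) → l w = 0) : w ∈ K := by
  rw [← Subspace.forall_mem_dualAnnihilator_apply_eq_zero_iff]
  intro l hl
  exact h l fun z hz => (Submodule.mem_dualAnnihilator l).1 hl z hz

theorem dirDeriv_mem {U : Set F} (hU : IsOpen U) {f : F → V} (hf : IsSmoothInto U f) (y : F)
    {K : Submodule ℝ V} {w : V} (hK : ∀ x ∈ U, f x - w ∈ K) {x : F} (hx : x ∈ U) :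
    dirDeriv y f x ∈ K := by
  refine mem_of_forall_dual fun l hl => ?_
  rw [dual_dirDeriv hU hf y l hx]
  have e : (fun x => l (f x)) =ᶠ[𝓝 x] fun _ => l w := by
    filter_upwards [hU.mem_nhds hx] with z hz
    have := hl _ (hK z hz)
    rwa [map_sub, sub_eq_zero] at this
  rw [e.fderiv_eq]
  simp

/-- The iterated derivatives in a fixed direction give the diagonal values of the iterated
derivatives of the components. -/
theorem iteratedFDeriv_eq_dual_iterate {U : Set F} (hU : IsOpen U) {f : F → V}
    (hf : IsSmoothInto U f) (y : F) (l : Module.Dual ℝ V) (n : ℕ) {x : F} (hx : x ∈ U) :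
    iteratedFDeriv ℝ n (fun x => l (f x)) x (fun _ => y) = l ((dirDeriv y)^[n] f x) := by
  have hn (n : ℕ) : IsSmoothInto U ((_root_.dirDeriv y)^[n] f) := by
    induction n with
    | zero => exact hf
    | succ n ih =>
      rw [Function.iterate_succ_apply']
      exact ih.dirDeriv hU y
  induction n generalizing x with
  | zero => simp
  | succ n ih =>
    rw [Function.iterate_succ_apply', dual_dirDeriv hU (hn n) y l hx]
    have e : (fun x => l ((_root_.dirDeriv y)^[n] f x)) =ᶠ[𝓝 x]
        fun x => iteratedFDeriv ℝ n (fun x => l (f x)) x (fun _ => y) := by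
      filter_upwards [hU.mem_nhds hx] with z hz using (ih hz).symm
    rw [e.fderiv_eq, iteratedFDeriv_succ_apply_left]
    have hd : DifferentiableAt ℝ (iteratedFDeriv ℝ n fun x => l (f x)) x :=
      ((hf l).contDiffAt (hU.mem_nhds hx)).differentiableAt_iteratedFDeriv (by
        exact_mod_cast ENat.natCast_lt_top n)
    rw [fderiv_continuousMultilinear_apply_const_apply hd]
    rfl

end SmoothInto

section Bracket

variable {F : Type*} [NormedAddCommGroup F] [NormedSpace ℝ F] [CompleteSpace F]
  {H : Type*} [TopologicalSpace H] {I : ModelWithCorners ℝ F H}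
  {N : Type*} [TopologicalSpace N] [ChartedSpace H N] [IsManifold I ∞ N]

theorem mlieBracket_sum_smul_right {ι : Type*} (s : Finset ι) {φ : ι → N → ℝ}
    {A : ι → ∀ p : N, TangentSpace I p} (B : ∀ p : N, TangentSpace I p) {p : N}
    (hφ : ∀ i, MDifferentiableAt I 𝓘(ℝ, ℝ) (φ i) p)
    (hA : ∀ i, MDifferentiableAt I I.tangent (fun p => (⟨p, A i p⟩ : TangentBundle I N)) p) :
    VectorField.mlieBracket I B (fun q => ∑ i ∈ s, φ i q • A i q) p =
      ∑ i ∈ s, (applyField B (φ i) p • A i p + φ i p • VectorField.mlieBracket I B (A i) p) := by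
  classical
  have := isManifold_one_of_infty (I := I) (N := N)
  have := isManifold_two_of_infty (I := I) (N := N)
  have hφA (i : ι) : MDifferentiableAt I I.tangent
      (fun p => (⟨p, φ i p • A i p⟩ : TangentBundle I N)) p := (hφ i).smul_section (hA i)
  have hsum (s : Finset ι) : MDifferentiableAt I I.tangent
      (fun p => (⟨p, ∑ i ∈ s, φ i p • A i p⟩ : TangentBundle I N)) p :=
    MDifferentiableAt.sum_section fun i _ => hφA i
  induction s using Finset.induction_on with
  | empty =>
    simp only [Finset.sum_empty]
    exact congrFun (VectorField.mlieBracket_zero_right (I := I) (W := B)) p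
  | insert i s hi ih =>
    simp only [Finset.sum_insert hi, ← ih]
    refine (VectorField.mlieBracket_add_right (hφA i) (hsum s)).trans (congrArg (· + _) ?_)
    exact VectorField.mlieBracket_smul_right (hφ i) (hA i)

end Bracket

/-! ### Fields with coefficients in the parabolic module -/

section Sufficiency

variable {E : Type*} [NormedAddCommGroup E] [NormedSpace ℝ E] [FiniteDimensional ℝ E]
  {G : Type*} [TopologicalSpace G] [ChartedSpace E G] [Group G] [LieGroup 𝓘(ℝ, E) ∞ G]
  {F : Type*} [NormedAddCommGroup F] [NormedSpace ℝ F] [FiniteDimensional ℝ F]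

theorem ContDiffOn.contMDiffOn_comp_snd {U : Set F} {φ : F → ℝ} (hφ : ContDiffOn ℝ ∞ φ U) :
    ContMDiffOn (𝓘(ℝ, E).prod 𝓘(ℝ, F)) 𝓘(ℝ, ℝ) ∞ (fun p : G × F => φ p.2)
      ((univ : Set G) ×ˢ U) :=
  hφ.contMDiffOn.comp contMDiff_snd.contMDiffOn fun _ hp => hp.2

theorem applyField_comp_snd (Y : ∀ p : G × F, TangentSpace (𝓘(ℝ, E).prod 𝓘(ℝ, F)) p) {φ : F → ℝ}
    {p : G × F} (hφ : DifferentiableAt ℝ φ p.2) :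
    applyField Y (fun q => φ q.2) p = fderiv ℝ φ p.2 (Y p).2 :=
  DFunLike.congr_fun (hφ.hasFDerivAt.hasMFDerivAt.comp p
    (hasMFDerivAt_snd (I := 𝓘(ℝ, E)) (I' := 𝓘(ℝ, F)) p)).mfderiv (Y p)

theorem isSmoothField_frameField_snd {U : Set F} {W : F → LieAlgOf E G} {c : F → F}
    (hW : IsSmoothInto U W) (hc : IsSmoothInto U c) :
    IsSmoothField ((univ : Set G) ×ˢ U) (frameField (fun q => W q.2) fun q => c q.2) :=
  isSmoothField_frameField (fun l => (hW l).contMDiffOn_comp_snd)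
    fun l => (hc l).contMDiffOn_comp_snd

/-- `[e_w + ∂_y, e_W] = e_{∂_y W + [w, W]}` for a map `W` from the second factor to `𝔤`. -/
theorem mlieBracket_frameField_snd {U : Set F} (hU : IsOpen U) {W : F → LieAlgOf E G}
    (hW : IsSmoothInto U W) (w : LieAlgOf E G) (y : F) {p : G × F} (hp : p.2 ∈ U) :
    VectorField.mlieBracket (𝓘(ℝ, E).prod 𝓘(ℝ, F)) (frameField (fun _ => w) fun _ => y)
      (frameField (fun q => W q.2) fun _ => 0) p =
        frameMap p (dirDeriv y W p.2 + ⁅w, W p.2⁆, 0) := by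
  have := FiniteDimensional.complete ℝ E
  have := FiniteDimensional.complete ℝ F
  let β := Module.finBasis ℝ (LieAlgOf E G)
  have hd (i) : DifferentiableAt ℝ (fun x => β.coord i (W x)) p.2 :=
    ((hW (β.coord i)).contDiffAt (hU.mem_nhds hp)).differentiableAt (by simp)
  have e : frameField (fun q : G × F => W q.2) (fun _ => (0 : F)) = fun q =>
      ∑ i, β.coord i (W q.2) • frameField (fun _ => β i) (fun _ => 0) q := by
    ext1 q
    simp only [frameField, ← map_smul, ← map_sum]
    congr 1
    refine Prod.ext ?_ ?_
    · simp [Prod.fst_sum, β.sum_repr]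
    · simp [Prod.snd_sum]
  have hφ (i) : MDifferentiableAt (𝓘(ℝ, E).prod 𝓘(ℝ, F)) 𝓘(ℝ, ℝ)
      (fun q : G × F => β.coord i (W q.2)) p :=
    (((hW (β.coord i)).contMDiffOn_comp_snd (E := E) (G := G)).contMDiffAt
      ((isOpen_univ.prod hU).mem_nhds ⟨mem_univ _, hp⟩)).mdifferentiableAt (by simp)
  rw [e, mlieBracket_sum_smul_right Finset.univ _ hφ fun i =>
    (isSmoothField_frameField_const univ (β i) (0 : F)).mdifferentiableAt isOpen_univ (mem_univ p)]
  simp only [mlieBracket_frameField_const]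
  have e2 (i) : applyField (frameField (fun _ => w) fun _ => y)
      (fun q : G × F => β.coord i (W q.2)) p = fderiv ℝ (fun x => β.coord i (W x)) p.2 y :=
    applyField_comp_snd _ (hd i)
  simp only [e2, frameField, ← map_smul, ← map_sum, ← map_add]
  congr 1
  refine Prod.ext ?_ ?_
  · simp only [Prod.fst_sum, Prod.fst_add, Prod.smul_fst, Finset.sum_add_distrib]
    congr 1
    conv_rhs => rw [← β.sum_repr (W p.2), lie_sum]
    simp
  · simp [Prod.snd_sum]

variable {U : Set F} {v : F → LieAlgOf E G} {c : F → F} {m : ℕ} {σ : Fin m → F → F}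

/-- The parabolic Lie module over `G × U` of the fields `X_0 = v + c` and `X_k = σ_k`, where `v`
is along `G`, while `c` and the `σ_k` are along `F`, and they are independent of the group
variable. -/
def InFrameModule (v : F → LieAlgOf E G) (c : F → F) (σ : Fin m → F → F) (U : Set F)
    (A : ∀ p : G × F, TangentSpace (𝓘(ℝ, E).prod 𝓘(ℝ, F)) p) : Prop :=
  InParabolicModule ((univ : Set G) ×ˢ U) (frameField (fun q => v q.2) fun q => c q.2)
    (fun k => frameField (fun _ => 0) fun q => σ k q.2) A

/-- The `σ_k` span `F` at the points of `U`, with smooth coefficients. -/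
def SmoothlySpans (σ : Fin m → F → F) (U : Set F) : Prop :=
  ∀ y : F, ∃ a : Fin m → F → ℝ, (∀ k, ContDiffOn ℝ ∞ (a k) U) ∧ ∀ x ∈ U, ∑ k, a k x • σ k x = y

theorem SmoothlySpans.mono {U' : Set F} (h : SmoothlySpans σ U) (hU : U' ⊆ U) :
    SmoothlySpans σ U' := fun y => by
  obtain ⟨a, ha, e⟩ := h y
  exact ⟨a, fun k => (ha k).mono hU, fun x hx => e x (hU hx)⟩

namespace InFrameModule

theorem const_vert (hσ : SmoothlySpans σ U) (y : F) :
    InFrameModule (G := G) v c σ U (frameField (fun _ => 0) fun _ => y) := by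
  obtain ⟨a, ha, e⟩ := hσ y
  refine (InParabolicModule.sum Finset.univ fun k _ => InParabolicModule.smul
    (ha k).contMDiffOn_comp_snd (InParabolicModule.field k)).congr fun p hp => ?_
  simp only [frameField, ← map_smul, ← map_sum]
  congr 1
  refine Prod.ext ?_ ?_
  · simp [Prod.fst_sum]
  · simp [Prod.snd_sum, e p.2 hp.2]

theorem vert (hσ : SmoothlySpans σ U) {b : F → F} (hb : IsSmoothInto U b) :
    InFrameModule (G := G) v c σ U (frameField (fun _ => 0) fun q => b q.2) := by
  let β := Module.finBasis ℝ F
  refine (InParabolicModule.sum Finset.univ fun k _ => InParabolicModule.smul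
    (hb (β.coord k)).contMDiffOn_comp_snd (const_vert hσ (β k))).congr fun p hp => ?_
  simp only [frameField, ← map_smul, ← map_sum]
  congr 1
  refine Prod.ext ?_ ?_
  · simp [Prod.fst_sum]
  · simp [Prod.snd_sum, β.sum_repr]

/-- The module is stable under brackets with the velocity field: it is `X_0` up to the field `c`,
which belongs to the module because the `σ_k` span. -/
theorem ad_velocity (hU : IsOpen U) (hv : IsSmoothInto U v) (hc : IsSmoothInto U c)
    (hσ : SmoothlySpans σ U)
    {A : ∀ p : G × F, TangentSpace (𝓘(ℝ, E).prod 𝓘(ℝ, F)) p}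
    (hA : InFrameModule v c σ U A) :
    InFrameModule v c σ U (VectorField.mlieBracket (𝓘(ℝ, E).prod 𝓘(ℝ, F))
      (frameField (fun q => v q.2) fun _ => 0) A) := by
  have := FiniteDimensional.complete ℝ E
  have := FiniteDimensional.complete ℝ F
  have := isManifold_two_of_infty (I := 𝓘(ℝ, E).prod 𝓘(ℝ, F)) (N := G × F)
  have hΩ : IsOpen ((univ : Set G) ×ˢ U) := isOpen_univ.prod hU
  have h1 : InFrameModule v c σ U (VectorField.mlieBracket (𝓘(ℝ, E).prod 𝓘(ℝ, F))
      (frameField (fun _ => 0) fun q => c q.2) A) := InParabolicModule.lie hΩ (vert hσ hc) hA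
  refine ((InParabolicModule.ad hΩ hA).add h1.neg).congr fun p hp => ?_
  have e : frameField (fun q : G × F => v q.2) (fun q => c q.2) =
      frameField (fun q => v q.2) (fun _ => 0) + frameField (fun _ => 0) fun q => c q.2 := by
    ext1 q
    simp only [Pi.add_apply, frameField, ← map_add, Prod.mk_add_mk, add_zero, zero_add]
  rw [e, VectorField.mlieBracket_add_left]
  · simp
  · exact (isSmoothField_frameField_snd hv (isSmoothInto_const U 0)).mdifferentiableAt hΩ hp
  · exact (isSmoothField_frameField_snd (isSmoothInto_const U 0) hc).mdifferentiableAt hΩ hp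

/-- The bracket of `∂_y` with the velocity field is the field with coefficient `∂_y v`. -/
theorem dirDeriv_velocity (hU : IsOpen U) (hv : IsSmoothInto U v) (hc : IsSmoothInto U c)
    (hσ : SmoothlySpans σ U) (y : F) :
    InFrameModule (G := G) v c σ U (frameField (fun q => dirDeriv y v q.2) fun _ => 0) := by
  refine (ad_velocity hU hv hc hσ (const_vert hσ y)).neg.congr fun p hp => ?_
  rw [← VectorField.mlieBracket_swap_apply, mlieBracket_frameField_snd hU hv _ _ hp.2]
  simp [frameField]

theorem dirDeriv (hU : IsOpen U) (hσ : SmoothlySpans σ U) {W : F → LieAlgOf E G}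
    (hW : IsSmoothInto U W)
    (h : InFrameModule v c σ U (frameField (fun q => W q.2) fun _ => 0)) (y : F) :
    InFrameModule v c σ U (frameField (fun q => dirDeriv y W q.2) fun _ => 0) := by
  refine (InParabolicModule.lie (isOpen_univ.prod hU) (const_vert hσ y) h).congr fun p hp => ?_
  rw [mlieBracket_frameField_snd hU hW _ _ hp.2]
  simp [frameField]

/-- Bracketing with the velocity field turns `e_z` into the field with the variable coefficient
`[v, z]`. -/
theorem lie_velocity (hU : IsOpen U) (hv : IsSmoothInto U v) (hc : IsSmoothInto U c)
    (hσ : SmoothlySpans σ U) {z : LieAlgOf E G}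
    (h : InFrameModule v c σ U (frameField (fun _ => z) fun _ => 0)) :
    InFrameModule v c σ U (frameField (fun q => ⁅v q.2, z⁆) fun _ => 0) := by
  refine (ad_velocity hU hv hc hσ h).congr fun p hp => ?_
  rw [VectorField.mlieBracket_swap_apply, mlieBracket_frameField_snd hU hv _ _ hp.2, ← map_neg]
  have e : _root_.dirDeriv (0 : F) v p.2 = 0 := by simp [_root_.dirDeriv]
  simp [frameField, e]

end InFrameModule

end Sufficiency

/-! ### Sufficiency: filling the tangent spaces -/

section SmoothMatrix

variable {F : Type*} [NormedAddCommGroup F] [NormedSpace ℝ F] {n : Type*} [Fintype n]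
  [DecidableEq n]

theorem contDiffOn_det {U : Set F} {T : F → Matrix n n ℝ}
    (hT : ∀ i j, ContDiffOn ℝ ∞ (fun x => T x i j) U) : ContDiffOn ℝ ∞ (fun x => (T x).det) U := by
  simp only [Matrix.det_apply']
  exact ContDiffOn.sum fun σ _ => contDiffOn_const.mul (contDiffOn_prod fun i _ => hT _ _)

theorem contDiffOn_matrix_inv {U : Set F} {T : F → Matrix n n ℝ}
    (hT : ∀ i j, ContDiffOn ℝ ∞ (fun x => T x i j) U) (h : ∀ x ∈ U, (T x).det ≠ 0) (i j : n) :
    ContDiffOn ℝ ∞ (fun x => (T x)⁻¹ i j) U := by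
  simp only [Matrix.inv_def, Ring.inverse_eq_inv', Matrix.smul_apply, smul_eq_mul,
    Matrix.adjugate_apply]
  refine ((contDiffOn_det hT).inv h).mul (contDiffOn_det fun k l => ?_)
  by_cases hk : k = j
  · subst hk
    simpa using contDiffOn_const
  · simpa [Matrix.updateRow_ne hk] using hT k l

end SmoothMatrix

section Sufficiency

variable {E : Type*} [NormedAddCommGroup E] [NormedSpace ℝ E] [FiniteDimensional ℝ E]
  {G : Type*} [TopologicalSpace G] [ChartedSpace E G] [Group G] [LieGroup 𝓘(ℝ, E) ∞ G]
  {F : Type*} [NormedAddCommGroup F] [NormedSpace ℝ F] [FiniteDimensional ℝ F]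

variable {U : Set F} {v : F → LieAlgOf E G} {c : F → F} {m : ℕ} {σ : Fin m → F → F}
  {S : Set (LieAlgOf E G)}

/-- The differences of velocities are spanned by the values at `x₀` of the iterated derivatives of
the velocity. Fields with these coefficients belong to the module and form a frame near `x₀` for the
left-invariant fields from the span of `S - S`, hence the latter belong to the module as well. -/
theorem exists_inFrameModule_const_of_mem_span (hU : IsOpen U) (hv : IsSmoothInto U v)
    (hc : IsSmoothInto U c) (hσ : SmoothlySpans σ U)
    (hvS : ∀ x ∈ U, v x ∈ S) {x₀ : F} (hx₀ : x₀ ∈ U)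
    (sep : ∀ l : Module.Dual ℝ (LieAlgOf E G),
      (∀ (y : F) (n : ℕ), iteratedFDeriv ℝ (n + 1) (fun x => l (v x)) x₀ (fun _ => y) = 0) →
      ∀ s₁ ∈ S, ∀ s₂ ∈ S, l s₁ = l s₂) :
    ∃ U' ⊆ U, IsOpen U' ∧ x₀ ∈ U' ∧ ∀ s₁ ∈ S, ∀ s₂ ∈ S,
      InFrameModule v c σ U' (frameField (fun _ => s₁ - s₂) fun _ => 0) := by
  set K : Submodule ℝ (LieAlgOf E G) := Submodule.span ℝ {z | ∃ s₁ ∈ S, ∃ s₂ ∈ S, z = s₁ - s₂}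
    with hK
  have subK {s₁ s₂ : LieAlgOf E G} (h₁ : s₁ ∈ S) (h₂ : s₂ ∈ S) : s₁ - s₂ ∈ K :=
    Submodule.subset_span ⟨_, h₁, _, h₂, rfl⟩
  let Good (W : F → LieAlgOf E G) : Prop := IsSmoothInto U W ∧ (∀ x ∈ U, W x ∈ K) ∧
    ∀ U' ⊆ U, IsOpen U' → InFrameModule v c σ U' (frameField (fun q => W q.2) fun _ => 0)
  have good_iter (y : F) (n : ℕ) : Good ((dirDeriv y)^[n + 1] v) := by
    induction n with
    | zero =>
      refine ⟨hv.dirDeriv hU y, fun x hx => dirDeriv_mem hU hv y (w := v x₀)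
        (fun x hx => subK (hvS x hx) (hvS x₀ hx₀)) hx, fun U' h hU' => ?_⟩
      exact InFrameModule.dirDeriv_velocity hU' (hv.mono h) (hc.mono h) (hσ.mono h) y
    | succ n ih =>
      rw [Function.iterate_succ_apply']
      obtain ⟨h1, h2, h3⟩ := ih
      refine ⟨h1.dirDeriv hU y, fun x hx => dirDeriv_mem hU h1 y (w := 0) (by simpa using h2) hx,
        fun U' h hU' => ?_⟩
      exact InFrameModule.dirDeriv hU' (hσ.mono h) (h1.mono h) (h3 U' h hU') y
  -- the values at `x₀` of the coefficients of fields in the module that take values in `K`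
  let K₀ : Submodule ℝ (LieAlgOf E G) :=
    { carrier := {z | ∃ W, Good W ∧ W x₀ = z}
      zero_mem' := by
        refine ⟨fun _ => 0, ⟨isSmoothInto_const U 0, fun _ _ => K.zero_mem, fun U' _ _ => ?_⟩, rfl⟩
        exact InParabolicModule.zero.congr fun p _ => map_zero (frameMap p)
      add_mem' := by
        rintro _ _ ⟨W, ⟨h1, h2, h3⟩, rfl⟩ ⟨W', ⟨h1', h2', h3'⟩, rfl⟩
        refine ⟨fun x => W x + W' x, ⟨h1.add h1', fun x hx => K.add_mem (h2 x hx) (h2' x hx),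
          fun U' h hU' => ?_⟩, rfl⟩
        refine (InParabolicModule.add (h3 U' h hU') (h3' U' h hU')).congr fun p _ => ?_
        simp only [frameField, ← map_add, Prod.mk_add_mk, add_zero]
      smul_mem' := by
        rintro r _ ⟨W, ⟨h1, h2, h3⟩, rfl⟩
        refine ⟨fun x => r • W x, ⟨h1.const_smul r, fun x hx => K.smul_mem r (h2 x hx),
          fun U' h hU' => ?_⟩, rfl⟩
        refine (InParabolicModule.smul (φ := fun _ => r) contMDiffOn_const (h3 U' h hU')).congr
          fun p _ => ?_
        simp only [frameField, ← map_smul, Prod.smul_mk, smul_zero] }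
  have hKK₀ : K ≤ K₀ := by
    rw [hK, Submodule.span_le]
    rintro _ ⟨s₁, h₁, s₂, h₂, rfl⟩
    refine mem_of_forall_dual fun l hl => ?_
    rw [map_sub, sub_eq_zero]
    refine sep l (fun y n => ?_) s₁ h₁ s₂ h₂
    rw [iteratedFDeriv_eq_dual_iterate hU hv y l (n + 1) hx₀]
    exact hl _ ⟨_, good_iter y n, rfl⟩
  obtain ⟨n, b, l, hb, hlb, hbl⟩ := K.exists_coordinates
  choose W hW hWx₀ using fun i => hKK₀ (hb i)
  -- the fields with coefficients `W i` have the values `b i` at `x₀`, and `T` expresses them through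
  -- the `b j`; inverting `T` near `x₀` gives the constant fields
  let T : F → Matrix (Fin n) (Fin n) ℝ := fun x => Matrix.of fun j i => l j (W i x)
  have hT : ∀ i j, ContDiffOn ℝ ∞ (fun x => T x i j) U := fun i j => (hW j).1 (l i)
  have hT₀ : (T x₀).det ≠ 0 := by
    have : T x₀ = 1 := by
      ext i j
      simp [T, hWx₀, hlb, Matrix.one_apply]
    simp [this]
  let U' := U ∩ (fun x => (T x).det) ⁻¹' {0}ᶜ
  have hU'U : U' ⊆ U := inter_subset_left
  have hU' : IsOpen U' :=
    (contDiffOn_det hT).continuousOn.isOpen_inter_preimage hU isOpen_compl_singleton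
  have hinv := contDiffOn_matrix_inv (U := U') (fun i j => (hT i j).mono hU'U) fun x hx => hx.2
  have hbmod (k : Fin n) : InFrameModule v c σ U' (frameField (fun _ => b k) fun _ => 0) := by
    refine (InParabolicModule.sum Finset.univ fun i _ => InParabolicModule.smul
      (hinv i k).contMDiffOn_comp_snd ((hW i).2.2 U' hU'U hU')).congr fun p hp => ?_
    simp only [frameField, ← map_smul, ← map_sum]
    congr 1
    refine Prod.ext ?_ (by simp [Prod.snd_sum])
    simp only [Prod.fst_sum, Prod.smul_fst]
    have hp2 : p.2 ∈ U' := hp.2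
    have e (i : Fin n) : W i p.2 = ∑ j, T p.2 j i • b j := (hbl _ ((hW i).2.1 _ (hU'U hp2))).symm
    have hTT : T p.2 * (T p.2)⁻¹ = 1 :=
      Matrix.mul_nonsing_inv _ (isUnit_iff_ne_zero.2 hp2.2)
    simp only [e, Finset.smul_sum, smul_smul]
    rw [Finset.sum_comm]
    have e2 (j : Fin n) : ∑ i, ((T p.2)⁻¹ i k * T p.2 j i) • b j =
        (1 : Matrix (Fin n) (Fin n) ℝ) j k • b j := by
      rw [← hTT, Matrix.mul_apply, Finset.sum_smul]
      simp only [mul_comm]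
    simp [e2, Matrix.one_apply]
  refine ⟨U', hU'U, hU', ⟨hx₀, hT₀⟩, fun s₁ h₁ s₂ h₂ => ?_⟩
  refine (InParabolicModule.sum Finset.univ fun k _ => InParabolicModule.smul
    (φ := fun _ => l k (s₁ - s₂)) contMDiffOn_const (hbmod k)).congr fun p hp => ?_
  simp only [frameField, ← map_smul, ← map_sum]
  congr 1
  refine Prod.ext ?_ (by simp [Prod.snd_sum])
  simp only [Prod.fst_sum, Prod.smul_fst, hbl _ (subK h₁ h₂)]

/-- If the left-invariant fields from `S - S` belong to the module, then so do all left-invariant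
fields from the p-hull of `S`. -/
theorem inFrameModule_const_of_mem_pHull (hU : IsOpen U) (hv : IsSmoothInto U v)
    (hc : IsSmoothInto U c) (hσ : SmoothlySpans σ U)
    (hvS : ∀ x ∈ U, v x ∈ S)
    (hS : ∀ s₁ ∈ S, ∀ s₂ ∈ S, InFrameModule v c σ U (frameField (fun _ => s₁ - s₂) fun _ => 0))
    {z : LieAlgOf E G} (hz : z ∈ pHull S) :
    InFrameModule v c σ U (frameField (fun _ => z) fun _ => 0) := by
  have hΩ : IsOpen ((univ : Set G) ×ˢ U) := isOpen_univ.prod hU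
  have add {z z' : LieAlgOf E G}
      (h : InFrameModule v c σ U (frameField (fun _ => z) fun _ => 0))
      (h' : InFrameModule v c σ U (frameField (fun _ => z') fun _ => 0)) :
      InFrameModule v c σ U (frameField (fun _ => z + z') fun _ => 0) := by
    refine (InParabolicModule.add h h').congr fun p _ => ?_
    simp only [frameField, ← map_add, Prod.mk_add_mk, add_zero]
  have smul (r : ℝ) {z : LieAlgOf E G}
      (h : InFrameModule v c σ U (frameField (fun _ => z) fun _ => 0)) :
      InFrameModule v c σ U (frameField (fun _ => r • z) fun _ => 0) := by
    refine (InParabolicModule.smul (φ := fun _ => r) contMDiffOn_const h).congr fun p _ => ?_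
    simp only [frameField, ← map_smul, Prod.smul_mk, smul_zero]
  have lie {z z' : LieAlgOf E G}
      (h : InFrameModule v c σ U (frameField (fun _ => z) fun _ => 0))
      (h' : InFrameModule v c σ U (frameField (fun _ => z') fun _ => 0)) :
      InFrameModule v c σ U (frameField (fun _ => ⁅z, z'⁆) fun _ => 0) := by
    refine (InParabolicModule.lie hΩ h h').congr fun p _ => ?_
    rw [mlieBracket_frameField_const]
  let 𝔥 : LieSubalgebra ℝ (LieAlgOf E G) :=
    { carrier := {z | InFrameModule v c σ U (frameField (fun _ => z) fun _ => 0)}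
      zero_mem' := InParabolicModule.zero.congr fun p _ => map_zero (frameMap p)
      add_mem' := add
      smul_mem' := fun r _ h => smul r h
      lie_mem' := lie }
  refine pHull_le (𝔥 := 𝔥) hS (fun s hs z hz => ?_) hz
  let K : Submodule ℝ (LieAlgOf E G) := Submodule.span ℝ {z | ∃ s₁ ∈ S, ∃ s₂ ∈ S, z = s₁ - s₂}
  have hK : K ≤ 𝔥.toSubmodule := by
    refine Submodule.span_le.2 ?_
    rintro _ ⟨s₁, h₁, s₂, h₂, rfl⟩
    exact hS s₁ h₁ s₂ h₂
  obtain ⟨n, b, l, hb, -, hbl⟩ := K.exists_coordinates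
  -- `[s, z] = [v(x), z] - [v(x) - s, z]`, where `v(x) - s` is a combination of the `b k ∈ 𝔥`
  have h1 := InFrameModule.lie_velocity hU hv hc hσ hz
  have h2 := InParabolicModule.sum Finset.univ fun k _ => InParabolicModule.smul
    ((hv (l k)).sub (contDiffOn_const (c := l k s))).contMDiffOn_comp_snd (lie (hK (hb k)) hz)
  refine (InParabolicModule.add h1 h2.neg).congr fun p hp => ?_
  simp only [frameField, ← map_smul, ← map_sum, ← map_neg, ← map_add]
  congr 1
  refine Prod.ext ?_ (by simp [Prod.snd_sum])
  have e : v p.2 - s = ∑ k, l k (v p.2 - s) • b k :=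
    (hbl _ (Submodule.subset_span ⟨_, hvS _ hp.2, _, hs, rfl⟩)).symm
  have e' : ⁅v p.2 - s, z⁆ = ∑ k, (l k (v p.2) - l k s) • ⁅b k, z⁆ := by
    conv_lhs => rw [e, sum_lie]
    simp
  simp only [Prod.fst_sum, Prod.smul_fst, Prod.fst_add, Prod.fst_neg, ← e']
  simp

/-- The algebraic part of the sufficiency of the condition on the p-hull: if the derivatives of the
velocity at `x₀` determine the span of the differences of velocities (hypothesis `sep`), then the
parabolic Lie module fills the tangent spaces over `x₀`. -/
theorem exists_parabolicLieModule_eq (hU : IsOpen U) (hv : IsSmoothInto U v)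
    (hc : IsSmoothInto U c) (hσ : SmoothlySpans σ U)
    (hvS : ∀ x ∈ U, v x ∈ S) {x₀ : F} (hx₀ : x₀ ∈ U)
    (sep : ∀ l : Module.Dual ℝ (LieAlgOf E G),
      (∀ (y : F) (n : ℕ), iteratedFDeriv ℝ (n + 1) (fun x => l (v x)) x₀ (fun _ => y) = 0) →
      ∀ s₁ ∈ S, ∀ s₂ ∈ S, l s₁ = l s₂) (hS : pHull S = ⊤) :
    ∃ U' ⊆ U, IsOpen U' ∧ x₀ ∈ U' ∧ ∀ (a : G)
      (ξ : TangentSpace (𝓘(ℝ, E).prod 𝓘(ℝ, F)) (a, x₀)),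
      ∃ A, ParabolicLieModule ((univ : Set G) ×ˢ U') (frameField (fun q => v q.2) fun q => c q.2)
        (fun k => frameField (fun _ => 0) fun q => σ k q.2) A ∧ A (a, x₀) = ξ := by
  obtain ⟨U', hU'U, hU', hx₀', h⟩ :=
    exists_inFrameModule_const_of_mem_span hU hv hc hσ hvS hx₀ sep
  refine ⟨U', hU'U, hU', hx₀', fun a ξ => ?_⟩
  obtain ⟨⟨w, y⟩, rfl⟩ := frameMap_surjective (E := E) (a, x₀) ξ
  have h1 := inFrameModule_const_of_mem_pHull hU' (hv.mono hU'U) (hc.mono hU'U)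
    (hσ.mono hU'U) (fun x hx => hvS x (hU'U hx)) h
    (z := w) (by rw [hS]; trivial)
  have h2 := InFrameModule.const_vert (G := G) (v := v) (c := c) (hσ.mono hU'U) y
  obtain ⟨A, hA, e⟩ := InParabolicModule.add h1 h2
  refine ⟨A, hA, ?_⟩
  rw [← e (a, x₀) ⟨mem_univ _, hx₀'⟩]
  simp only [frameField, ← map_add, Prod.mk_add_mk, add_zero, zero_add]

end Sufficiency

/-! ### The Laplace operator as a sum of squares -/

section Laplace

variable {d m : ℕ} {U : Set (EuclideanSpace ℝ (Fin d))}

theorem fderiv_apply_eq_sum_partialDeriv (u : EuclideanSpace ℝ (Fin d) → ℝ)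
    (x y : EuclideanSpace ℝ (Fin d)) : fderiv ℝ u x y = ∑ i, y i * partialDeriv i u x := by
  conv_lhs => rw [← (EuclideanSpace.basisFun (Fin d) ℝ).sum_repr y]
  simp [partialDeriv]

theorem contDiffOn_partialDeriv {F' : Type*} [NormedAddCommGroup F'] [NormedSpace ℝ F']
    (hU : IsOpen U) {u : EuclideanSpace ℝ (Fin d) → F'}
    (hu : ContDiffOn ℝ ∞ u U) (i : Fin d) : ContDiffOn ℝ ∞ (partialDeriv i u) U :=
  (hu.fderiv_of_isOpen hU (by simp)).clm_apply contDiffOn_const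

/-- The divergence of the vector field `σ` with respect to the volume element `s dx`. -/
def divergence (s : EuclideanSpace ℝ (Fin d) → ℝ)
    (σ : EuclideanSpace ℝ (Fin d) → EuclideanSpace ℝ (Fin d)) (x : EuclideanSpace ℝ (Fin d)) : ℝ :=
  (s x)⁻¹ * ∑ i, partialDeriv i (fun y => s y * σ y i) x

theorem contDiffOn_divergence (hU : IsOpen U) {s : EuclideanSpace ℝ (Fin d) → ℝ}
    {σ : EuclideanSpace ℝ (Fin d) → EuclideanSpace ℝ (Fin d)}
    (hs : ContDiffOn ℝ ∞ s U) (hs0 : ∀ x ∈ U, s x ≠ 0) (hσ : ContDiffOn ℝ ∞ σ U) :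
    ContDiffOn ℝ ∞ (divergence s σ) U :=
  (hs.inv hs0).mul <| ContDiffOn.sum fun i _ =>
    contDiffOn_partialDeriv hU (hs.mul (contDiffOn_euclidean.1 hσ i)) i

/-- If the vector fields `σ_k` satisfy `∑ σ_k ⊗ σ_k = r h⁻¹`, then `r` times the Laplace operator of
`h` is `u ↦ ∑ div ((σ_k u) σ_k) = ∑ σ_k (σ_k u) + ∑ (div σ_k) σ_k u`. -/
theorem laplaceBeltrami_eq_sum_sq (hU : IsOpen U)
    {h : EuclideanSpace ℝ (Fin d) → Matrix (Fin d) (Fin d) ℝ}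
    {σ : Fin m → EuclideanSpace ℝ (Fin d) → EuclideanSpace ℝ (Fin d)} {r : ℝ}
    (hdet : ∀ x ∈ U, √(h x).det ≠ 0) (hs : ContDiffOn ℝ ∞ (fun x => √(h x).det) U)
    (hσ : ∀ k, ContDiffOn ℝ ∞ (σ k) U)
    (hσh : ∀ x ∈ U, ∀ i j, ∑ k, σ k x i * σ k x j = r * (h x)⁻¹ i j)
    {u : EuclideanSpace ℝ (Fin d) → ℝ} (hu : ContDiffOn ℝ ∞ u U) {x : EuclideanSpace ℝ (Fin d)}
    (hx : x ∈ U) :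
    r * laplaceBeltrami h u x = ∑ k, fderiv ℝ (fun y => fderiv ℝ u y (σ k y)) x (σ k x)
      + fderiv ℝ u x (∑ k, divergence (fun y => √(h y).det) (σ k) x • σ k x) := by
  have hUx : U ∈ 𝓝 x := hU.mem_nhds hx
  have hDu : ∀ k, DifferentiableAt ℝ (fun y => fderiv ℝ u y (σ k y)) x := fun k =>
    ((((hu.fderiv_of_isOpen hU (by simp : (∞ : WithTop ℕ∞) + 1 ≤ ∞)).clm_apply
      (hσ k)).contDiffAt hUx).differentiableAt (by simp))
  have hsσ : ∀ k i, DifferentiableAt ℝ (fun y => √(h y).det * σ k y i) x := fun k i =>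
    ((hs.mul (contDiffOn_euclidean.1 (hσ k) i)).contDiffAt hUx).differentiableAt (by simp)
  have key : ∀ i, r * partialDeriv i
      (fun y => √(h y).det * ∑ j, (h y)⁻¹ i j * partialDeriv j u y) x =
      ∑ k, ((√(h x).det * σ k x i) * partialDeriv i (fun y => fderiv ℝ u y (σ k y)) x
        + partialDeriv i (fun y => √(h y).det * σ k y i) x * fderiv ℝ u x (σ k x)) := by
    intro i
    have e : (fun y => r • (√(h y).det * ∑ j, (h y)⁻¹ i j * partialDeriv j u y)) =ᶠ[𝓝 x]
        fun y => ∑ k, (√(h y).det * σ k y i) * fderiv ℝ u y (σ k y) := by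
      filter_upwards [hUx] with y hy
      simp only [fderiv_apply_eq_sum_partialDeriv, smul_eq_mul, Finset.mul_sum]
      rw [Finset.sum_comm]
      refine Finset.sum_congr rfl fun j _ => ?_
      calc _ = √(h y).det * (r * (h y)⁻¹ i j) * partialDeriv j u y := by ring
        _ = _ := by
          rw [← hσh y hy, Finset.mul_sum, Finset.sum_mul]
          exact Finset.sum_congr rfl fun k _ => by ring
    have e2 := e.fderiv_eq (𝕜 := ℝ)
    rw [fderiv_fun_sum (u := Finset.univ)
      (A := fun k y => √(h y).det * σ k y i * fderiv ℝ u y (σ k y))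
      fun k _ => (hsσ k i).mul (hDu k)] at e2
    have e3 := DFunLike.congr_fun e2 (EuclideanSpace.single i (1 : ℝ))
    refine (DFunLike.congr_fun (congrFun (fderiv_const_smul_field (𝕜 := ℝ) (R := ℝ) r) x)
      (EuclideanSpace.single i (1 : ℝ))).symm.trans (e3.trans ?_)
    simp only [sum_apply, fderiv_fun_mul (hsσ _ i) (hDu _)]
    refine Finset.sum_congr rfl fun k _ => ?_
    simp [partialDeriv, mul_comm]
  unfold laplaceBeltrami
  rw [mul_left_comm, Finset.mul_sum]
  simp only [key]
  rw [Finset.sum_comm, Finset.mul_sum, map_sum, ← Finset.sum_add_distrib]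
  refine Finset.sum_congr rfl fun k _ => ?_
  rw [Finset.sum_add_distrib, mul_add, map_smul, smul_eq_mul, divergence,
    fderiv_apply_eq_sum_partialDeriv (fun y => fderiv ℝ u y (σ k y)), ← Finset.sum_mul, mul_assoc]
  congr 1
  rw [Finset.mul_sum]
  refine Finset.sum_congr rfl fun i _ => ?_
  rw [mul_assoc, inv_mul_cancel_left₀ (hdet x hx)]

end Laplace

section SquareRoot

variable {d m : ℕ}

/-- The columns of `√r h⁻¹ T`; if `h = T Tᵀ`, they are vector fields `σ_k` with
`∑ σ_k ⊗ σ_k = r h⁻¹`. -/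
def diffusionFields (r : ℝ) (h : EuclideanSpace ℝ (Fin d) → Matrix (Fin d) (Fin d) ℝ)
    (T : EuclideanSpace ℝ (Fin d) → Matrix (Fin d) (Fin m) ℝ) (k : Fin m)
    (x : EuclideanSpace ℝ (Fin d)) : EuclideanSpace ℝ (Fin d) :=
  WithLp.toLp 2 fun i => √r * ((h x)⁻¹ * T x) i k

variable {U : Set (EuclideanSpace ℝ (Fin d))}
  {h : EuclideanSpace ℝ (Fin d) → Matrix (Fin d) (Fin d) ℝ}
  {T : EuclideanSpace ℝ (Fin d) → Matrix (Fin d) (Fin m) ℝ} {r : ℝ}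

theorem contDiffOn_diffusionFields (hh : ∀ i j, ContDiffOn ℝ ∞ (fun x => h x i j) U)
    (hdet : ∀ x ∈ U, (h x).det ≠ 0) (hT : ∀ i k, ContDiffOn ℝ ∞ (fun x => T x i k) U)
    (k : Fin m) : ContDiffOn ℝ ∞ (diffusionFields r h T k) U := by
  refine contDiffOn_euclidean.2 fun i => ?_
  simp only [diffusionFields, Matrix.mul_apply]
  exact contDiffOn_const.mul <| ContDiffOn.sum fun j _ =>
    (contDiffOn_matrix_inv hh hdet i j).mul (hT j k)

theorem sum_diffusionFields_mul (hr : 0 ≤ r) {x : EuclideanSpace ℝ (Fin d)}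
    (hdet : (h x).det ≠ 0) (hT : h x = T x * (T x).transpose) (i j : Fin d) :
    ∑ k, diffusionFields r h T k x i * diffusionFields r h T k x j = r * (h x)⁻¹ i j := by
  have hs : (h x).transpose = h x := by rw [hT]; simp [Matrix.transpose_mul]
  have e : ((h x)⁻¹ * T x) * ((h x)⁻¹ * T x).transpose = (h x)⁻¹ := by
    rw [Matrix.transpose_mul, Matrix.transpose_nonsing_inv, hs, ← Matrix.mul_assoc,
      Matrix.mul_assoc (h x)⁻¹, ← hT, Matrix.nonsing_inv_mul _ (isUnit_iff_ne_zero.2 hdet),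
      Matrix.one_mul]
  conv_rhs => rw [← e, Matrix.mul_apply, Finset.mul_sum]
  refine Finset.sum_congr rfl fun k _ => ?_
  simp only [diffusionFields, Matrix.transpose_apply]
  linear_combination (((h x)⁻¹ * T x) i k * ((h x)⁻¹ * T x) j k) * Real.mul_self_sqrt hr

/-- `y = ∑ r⁻¹ (σ_k · h y) σ_k`. -/
theorem smoothlySpans_diffusionFields (hr : 0 < r)
    (hh : ∀ i j, ContDiffOn ℝ ∞ (fun x => h x i j) U)
    (hdet : ∀ x ∈ U, (h x).det ≠ 0) (hT : ∀ i k, ContDiffOn ℝ ∞ (fun x => T x i k) U)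
    (hTT : ∀ x ∈ U, h x = T x * (T x).transpose) :
    SmoothlySpans (diffusionFields r h T) U := by
  intro y
  refine ⟨fun k x => r⁻¹ * ∑ i, diffusionFields r h T k x i * ∑ j, h x i j * y j, fun k => ?_,
    fun x hx => ?_⟩
  · exact contDiffOn_const.mul <| ContDiffOn.sum fun i _ =>
      (contDiffOn_euclidean.1 (contDiffOn_diffusionFields hh hdet hT k) i).mul <|
        ContDiffOn.sum fun j _ => (hh i j).mul contDiffOn_const
  · ext l
    have e : ((h x)⁻¹ * h x).mulVec y = y.ofLp := by
      rw [Matrix.nonsing_inv_mul _ (isUnit_iff_ne_zero.2 (hdet x hx)), Matrix.one_mulVec]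
    rw [← Matrix.mulVec_mulVec] at e
    rw [← congrFun e l, WithLp.ofLp_sum, Finset.sum_apply, Matrix.mulVec, dotProduct]
    simp only [PiLp.smul_apply, smul_eq_mul]
    calc _ = ∑ k, ∑ i, r⁻¹ * (diffusionFields r h T k x l * diffusionFields r h T k x i)
            * (h x).mulVec y i := by
          refine Finset.sum_congr rfl fun k _ => ?_
          rw [Finset.mul_sum, Finset.sum_mul]
          exact Finset.sum_congr rfl fun i _ => by simp only [Matrix.mulVec, dotProduct]; ring
      _ = _ := by
          rw [Finset.sum_comm]
          refine Finset.sum_congr rfl fun i _ => ?_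
          rw [← Finset.sum_mul, ← Finset.mul_sum,
            sum_diffusionFields_mul hr.le (hdet x hx) (hTT x hx), inv_mul_cancel_left₀ hr.ne']

end SquareRoot

/-! ### The Fokker-Planck operator as a sum of squares -/

section SumOfSquares

variable {E : Type*} [NormedAddCommGroup E] [NormedSpace ℝ E] [FiniteDimensional ℝ E]
  {G : Type*} [TopologicalSpace G] [ChartedSpace E G] [Group G] [LieGroup 𝓘(ℝ, E) ∞ G]
  {F : Type*} [NormedAddCommGroup F] [NormedSpace ℝ F]

theorem applyField_frameField (W : G × F → LieAlgOf E G) (c : G × F → F) {f : G × F → ℝ} {a : G}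
    {x : F} (hf : MDifferentiableAt (𝓘(ℝ, E).prod 𝓘(ℝ, F)) 𝓘(ℝ, ℝ) f (a, x)) :
    applyField (frameField W c) f (a, x) =
      applyField (I := 𝓘(ℝ, E)) (mulInvariantVectorField (W (a, x))) (fun b => f (b, x)) a
        + fderiv ℝ (fun y => f (a, y)) x (c (a, x)) := by
  have e := mfderiv_prod_eq_add_apply (v := frameField W c (a, x)) hf
  have e2 := DFunLike.congr_fun (mfderiv_eq_fderiv (𝕜 := ℝ) (f := fun y => f (a, y)) (x := x))
    (c (a, x))
  exact e.trans (congrArg (mfderiv 𝓘(ℝ, E) 𝓘(ℝ, ℝ) (fun b => f (b, x)) a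
    (mulInvariantVectorField (W (a, x)) a) + ·) e2)

theorem applyField_frameField_zero (c : G × F → F) {f : G × F → ℝ} {a : G} {x : F}
    (hf : MDifferentiableAt (𝓘(ℝ, E).prod 𝓘(ℝ, F)) 𝓘(ℝ, ℝ) f (a, x)) :
    applyField (frameField (fun _ => (0 : LieAlgOf E G)) c) f (a, x) =
      fderiv ℝ (fun y => f (a, y)) x (c (a, x)) := by
  have h0 : mulInvariantVectorField (0 : LieAlgOf E G) a = 0 :=
    map_zero (mfderiv 𝓘(ℝ, E) 𝓘(ℝ, E) (fun b : G => a * b) 1)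
  have e : applyField (I := 𝓘(ℝ, E)) (mulInvariantVectorField (0 : LieAlgOf E G))
      (fun b => f (b, x)) a = 0 :=
    (congrArg (mvfderiv 𝓘(ℝ, E) (fun b => f (b, x)) a) h0).trans (map_zero _)
  exact (applyField_frameField _ c hf).trans ((congrArg (· + _) e).trans (zero_add _))

variable {d m : ℕ} {W : Type*} [AddCommGroup W] [Module ℝ W] [TopologicalSpace W]
  {gW : MetricTensor W} {ρ : W → ℝ} {v : W → LieAlgOf E G} {B : W → W} {ε : ℝ}
  {ψ : EuclideanSpace ℝ (Fin d) → W} {U : Set (EuclideanSpace ℝ (Fin d))}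
  {σ : Fin m → EuclideanSpace ℝ (Fin d) → EuclideanSpace ℝ (Fin d)}

/-- The drift along `U`, in the coordinates given by `ψ`, that remains of the Fokker-Planck operator when
its second order part is written as the sum of the squares of the fields `σ_k`. -/
def driftField (gW : MetricTensor W) (ρ : W → ℝ) (B : W → W) (ψ : EuclideanSpace ℝ (Fin d) → W)
    (σ : Fin m → EuclideanSpace ℝ (Fin d) → EuclideanSpace ℝ (Fin d))
    (x : EuclideanSpace ℝ (Fin d)) : EuclideanSpace ℝ (Fin d) :=
  coordField B ψ x - ∑ k, divergence (fun y => √(conformalMetric gW ρ ψ y).det) (σ k) x • σ k x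

theorem contDiffOn_driftField (hU : IsOpen U)
    (hb : ContDiffOn ℝ ∞ (coordField B ψ) U)
    (hdet : ∀ x ∈ U, √(conformalMetric gW ρ ψ x).det ≠ 0)
    (hs : ContDiffOn ℝ ∞ (fun x => √(conformalMetric gW ρ ψ x).det) U)
    (hσ : ∀ k, ContDiffOn ℝ ∞ (σ k) U) :
    ContDiffOn ℝ ∞ (driftField gW ρ B ψ σ) U :=
  hb.sub <| ContDiffOn.sum fun k _ => (contDiffOn_divergence hU hs hdet (hσ k)).smul (hσ k)

theorem isSumOfSquares_fokkerPlanck (hU : IsOpen U)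
    (hv : IsSmoothInto U fun x => v (ψ x)) (hb : ContDiffOn ℝ ∞ (coordField B ψ) U)
    (hdet : ∀ x ∈ U, √(conformalMetric gW ρ ψ x).det ≠ 0)
    (hs : ContDiffOn ℝ ∞ (fun x => √(conformalMetric gW ρ ψ x).det) U)
    (hσ : ∀ k, ContDiffOn ℝ ∞ (σ k) U)
    (hσh : ∀ x ∈ U, ∀ i j, ∑ k, σ k x i * σ k x j =
      ε ^ 2 / 2 * (conformalMetric gW ρ ψ x)⁻¹ i j) :
    IsSumOfSquares (𝓘(ℝ, E).prod 𝓘(ℝ, EuclideanSpace ℝ (Fin d)))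
      (fokkerPlanck (G := G) gW ρ v B ε ψ) (univ ×ˢ U)
      (frameField (fun q => v (ψ q.2)) fun q => driftField gW ρ B ψ σ q.2)
      (fun k => frameField (fun _ => 0) fun q => σ k q.2) := by
  have hΩ : IsOpen ((univ : Set G) ×ˢ U) := isOpen_univ.prod hU
  have hX (k) : IsSmoothField ((univ : Set G) ×ˢ U)
      (frameField (fun _ => (0 : LieAlgOf E G)) fun q => σ k q.2) :=
    isSmoothField_frameField_snd (isSmoothInto_const U 0) (hσ k).isSmoothInto
  refine ⟨isSmoothField_frameField_snd hv
    (contDiffOn_driftField hU hb hdet hs hσ).isSmoothInto, hX, ?_⟩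
  rintro f hf t ⟨a, x⟩ ⟨-, hx⟩
  have hx : x ∈ U := hx
  have hft : ContMDiffOn (𝓘(ℝ, E).prod 𝓘(ℝ, EuclideanSpace ℝ (Fin d))) 𝓘(ℝ, ℝ) ∞
      (fun q : G × EuclideanSpace ℝ (Fin d) => f (t, q)) (univ ×ˢ U) :=
    hf.comp (contMDiff_const.prodMk contMDiff_id).contMDiffOn fun q hq => ⟨mem_univ _, hq⟩
  have hmd {φ : G × EuclideanSpace ℝ (Fin d) → ℝ}
      (hφ : ContMDiffOn (𝓘(ℝ, E).prod 𝓘(ℝ, EuclideanSpace ℝ (Fin d))) 𝓘(ℝ, ℝ) ∞ φ (univ ×ˢ U))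
      (y) (hy : y ∈ U) : MDifferentiableAt (𝓘(ℝ, E).prod 𝓘(ℝ, EuclideanSpace ℝ (Fin d)))
        𝓘(ℝ, ℝ) φ (a, y) :=
    (hφ.contMDiffAt (hΩ.mem_nhds ⟨mem_univ _, hy⟩)).mdifferentiableAt (by simp)
  have hu : ContDiffOn ℝ ∞ (fun y => f (t, (a, y))) U :=
    (hft.comp (contMDiff_const.prodMk contMDiff_id).contMDiffOn
      fun y hy => ⟨mem_univ _, hy⟩).contDiffOn
  have e0 := applyField_frameField (fun q : G × EuclideanSpace ℝ (Fin d) => v (ψ q.2))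
    (fun q => driftField gW ρ B ψ σ q.2) (hmd hft x hx)
  have e1 (k) : applyField (frameField (fun _ => (0 : LieAlgOf E G)) fun q => σ k q.2)
      (applyField (frameField (fun _ => (0 : LieAlgOf E G)) fun q => σ k q.2)
        fun q => f (t, q)) (a, x) =
      fderiv ℝ (fun y => fderiv ℝ (fun y => f (t, (a, y))) y (σ k y)) x (σ k x) := by
    rw [applyField_frameField_zero _ (hmd (contMDiffOn_applyField hΩ (hX k) hft) x hx)]
    refine DFunLike.congr_fun (Filter.EventuallyEq.fderiv_eq ?_) _
    filter_upwards [hU.mem_nhds hx] with y hy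
    exact applyField_frameField_zero _ (hmd hft y hy)
  have e2 := laplaceBeltrami_eq_sum_sq hU hdet hs hσ hσh hu hx
  simp only [e1]
  refine Eq.trans ?_ (congrArg (fun z => deriv (fun s => f (s, (a, x))) t + z - _) e0).symm
  simp only [fokkerPlanck, e2, driftField, map_sub]
  ring

end SumOfSquares

/-! ### The metric and the drift in local coordinates -/

/-- A metric tensor is a sum of squares of linear forms. -/
theorem MetricTensor.exists_form_eq_sum {V : Type*} [AddCommGroup V] [Module ℝ V]
    [FiniteDimensional ℝ V] (g : MetricTensor V) :
    ∃ (m : ℕ) (l : Fin m → Module.Dual ℝ V), ∀ x y, g.form x y = ∑ k, l k x * l k y := by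
  let _ : Invertible (2 : ℝ) := invertibleOfNonzero two_ne_zero
  obtain ⟨b, hb⟩ := LinearMap.BilinForm.exists_orthogonal_basis (B := g.form) ⟨g.symm⟩
  rw [LinearMap.isOrthoᵢ_def] at hb
  refine ⟨_, fun k => √(g.form (b k) (b k)) • b.coord k, fun x y => ?_⟩
  conv_lhs => rw [← b.sum_repr x, ← b.sum_repr y]
  simp only [map_sum, map_smul, LinearMap.smul_apply, smul_eq_mul,
    Module.Basis.coord_apply, LinearMap.sum_apply]
  refine Finset.sum_congr rfl fun k _ => ?_
  rw [Finset.sum_eq_single k (fun j _ hj => by simp [hb _ _ hj]) (by simp)]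
  linear_combination (-(b.repr x k * b.repr y k)) *
    Real.mul_self_sqrt (g.pos (b k) (b.ne_zero k)).le

section Param

variable {W : Type*} [NormedAddCommGroup W] [NormedSpace ℝ W] [FiniteDimensional ℝ W] {d : ℕ}
  {S : Set W} {U : Set (EuclideanSpace ℝ (Fin d))} {ψ : EuclideanSpace ℝ (Fin d) → W}
  {gW : MetricTensor W} {ρ : W → ℝ} {B : W → W}

theorem contDiffOn_of_forall_dual {F : Type*} [NormedAddCommGroup F] [NormedSpace ℝ F] {U : Set F}
    {f : F → W} (h : ∀ l : StrongDual ℝ W, ContDiffOn ℝ ∞ (fun x => l (f x)) U) :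
    ContDiffOn ℝ ∞ f U := by
  let β := Module.finBasis ℝ W
  have e : f = fun x => ∑ i, β.coord i (f x) • β i := by
    ext1 x
    exact (β.sum_repr (f x)).symm
  rw [e]
  exact ContDiffOn.sum fun i _ =>
    (h (LinearMap.toContinuousLinearMap (β.coord i))).smul contDiffOn_const

theorem IsLocalParam.contDiffOn (hψ : IsLocalParam S U ψ) : ContDiffOn ℝ ∞ ψ U :=
  contDiffOn_of_forall_dual fun l => (hψ.analytic l).contDiffOn hψ.isOpen.uniqueDiffOn

theorem form_fderiv_eq_sum (ψ : EuclideanSpace ℝ (Fin d) → W) (x b : EuclideanSpace ℝ (Fin d))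
    (i : Fin d) : gW.form (partialDeriv i ψ x) (fderiv ℝ ψ x b) =
      (inducedMetric gW ψ x).mulVec b i := by
  conv_lhs => rw [← (EuclideanSpace.basisFun (Fin d) ℝ).sum_repr b]
  simp [partialDeriv, inducedMetric, Matrix.mulVec, dotProduct, mul_comm]

theorem inducedMetric_posDef (gW : MetricTensor W) (hψ : IsLocalParam S U ψ)
    {x : EuclideanSpace ℝ (Fin d)} (hx : x ∈ U) : (inducedMetric gW ψ x).PosDef := by
  refine Matrix.PosDef.of_dotProduct_mulVec_pos ?_ fun y hy => ?_
  · ext i j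
    simp [inducedMetric, gW.symm]
  · have e : star y ⬝ᵥ (inducedMetric gW ψ x).mulVec y =
        gW.form (fderiv ℝ ψ x (WithLp.toLp 2 y)) (fderiv ℝ ψ x (WithLp.toLp 2 y)) := by
      conv_rhs => enter [1]; rw [← (EuclideanSpace.basisFun (Fin d) ℝ).sum_repr (WithLp.toLp 2 y)]
      simp only [map_sum, map_smul, LinearMap.sum_apply, LinearMap.smul_apply, smul_eq_mul,
        dotProduct, Pi.star_apply, star_trivial]
      refine Finset.sum_congr rfl fun i _ => ?_
      rw [← form_fderiv_eq_sum (gW := gW) ψ x (WithLp.toLp 2 y) i]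
      simp [partialDeriv]
    rw [e]
    refine gW.pos _ fun h0 => hy ?_
    have := hψ.immersion x hx (h0.trans (map_zero _).symm)
    exact congrArg WithLp.ofLp this

theorem inducedMetric_det_pos (gW : MetricTensor W) (hψ : IsLocalParam S U ψ)
    {x : EuclideanSpace ℝ (Fin d)} (hx : x ∈ U) : 0 < (inducedMetric gW ψ x).det :=
  (inducedMetric_posDef gW hψ hx).det_pos

theorem conformalMetric_det_pos (hψ : IsLocalParam S U ψ) (hρ : IsSmoothPositiveOn d S ρ)
    {x : EuclideanSpace ℝ (Fin d)} (hx : x ∈ U) : 0 < (conformalMetric gW ρ ψ x).det := by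
  rw [conformalMetric, Matrix.det_smul]
  exact mul_pos (pow_pos (Real.rpow_pos_of_pos (hρ.1 _ (hψ.mapsTo hx)) _) _)
    (inducedMetric_det_pos gW hψ hx)

theorem contDiffOn_linear_comp {F' : Type*} [NormedAddCommGroup F'] [NormedSpace ℝ F']
    {U : Set F'} {f : F' → W} (l : Module.Dual ℝ W) (hf : ContDiffOn ℝ ∞ f U) :
    ContDiffOn ℝ ∞ (fun x => l (f x)) U :=
  (LinearMap.toContinuousLinearMap l).contDiff.comp_contDiffOn hf

theorem contDiffOn_form {F' : Type*} [NormedAddCommGroup F'] [NormedSpace ℝ F'] {U : Set F'}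
    (gW : MetricTensor W) {f f' : F' → W} (hf : ContDiffOn ℝ ∞ f U) (hf' : ContDiffOn ℝ ∞ f' U) :
    ContDiffOn ℝ ∞ (fun x => gW.form (f x) (f' x)) U := by
  obtain ⟨m, l, hl⟩ := gW.exists_form_eq_sum
  simp only [hl]
  exact ContDiffOn.sum fun k _ =>
    (contDiffOn_linear_comp (l k) hf).mul (contDiffOn_linear_comp (l k) hf')

theorem contDiffOn_inducedMetric (gW : MetricTensor W) (hψ : IsLocalParam S U ψ) (i j : Fin d) :
    ContDiffOn ℝ ∞ (fun x => inducedMetric gW ψ x i j) U :=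
  contDiffOn_form gW (contDiffOn_partialDeriv hψ.isOpen hψ.contDiffOn i)
    (contDiffOn_partialDeriv hψ.isOpen hψ.contDiffOn j)

theorem contDiffOn_density_rpow (hψ : IsLocalParam S U ψ) (hρ : IsSmoothPositiveOn d S ρ) (p : ℝ) :
    ContDiffOn ℝ ∞ (fun x => ρ (ψ x) ^ p) U :=
  (hρ.2 U ψ hψ).rpow_const_of_ne fun _ hx => (hρ.1 _ (hψ.mapsTo hx)).ne'

theorem contDiffOn_conformalMetric (hψ : IsLocalParam S U ψ) (hρ : IsSmoothPositiveOn d S ρ)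
    (i j : Fin d) : ContDiffOn ℝ ∞ (fun x => conformalMetric gW ρ ψ x i j) U :=
  (contDiffOn_density_rpow hψ hρ _).mul (contDiffOn_inducedMetric gW hψ i j)

/-- The conformal metric has a smooth factorization `h = T Tᵀ`, where `T` consists of the components
of the `∂_i ψ` in an orthonormal basis of `W`, times `ρ^(1/d)`. For `d = 0` the exponents are junk
values, but then there is nothing to prove, `T` having no rows. -/
theorem exists_conformalMetric_eq (gW : MetricTensor W) (hψ : IsLocalParam S U ψ)
    (hρ : IsSmoothPositiveOn d S ρ) :
    ∃ (m : ℕ) (T : EuclideanSpace ℝ (Fin d) → Matrix (Fin d) (Fin m) ℝ),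
      (∀ i k, ContDiffOn ℝ ∞ (fun x => T x i k) U) ∧
      ∀ x ∈ U, conformalMetric gW ρ ψ x = T x * (T x).transpose := by
  obtain ⟨m, l, hl⟩ := gW.exists_form_eq_sum
  refine ⟨m, fun x => Matrix.of fun i k => ρ (ψ x) ^ (1 / (d : ℝ)) * l k (partialDeriv i ψ x),
    fun i k => (contDiffOn_density_rpow hψ hρ _).mul (contDiffOn_linear_comp (l k)
      (contDiffOn_partialDeriv hψ.isOpen hψ.contDiffOn i)), fun x hx => ?_⟩
  have e : ρ (ψ x) ^ (2 / (d : ℝ)) = ρ (ψ x) ^ (1 / (d : ℝ)) * ρ (ψ x) ^ (1 / (d : ℝ)) := by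
    rw [← Real.rpow_add (hρ.1 _ (hψ.mapsTo hx))]
    congr 1
    ring
  ext i j
  simp only [conformalMetric, inducedMetric, Matrix.smul_apply, Matrix.of_apply, smul_eq_mul, hl,
    Matrix.mul_apply, Matrix.transpose_apply, e, Finset.mul_sum]
  exact Finset.sum_congr rfl fun k _ => by ring

theorem fderiv_coordField {x : EuclideanSpace ℝ (Fin d)}
    (h : B (ψ x) ∈ range (fderiv ℝ ψ x)) : fderiv ℝ ψ x (coordField B ψ x) = B (ψ x) :=
  Function.invFun_eq h

/-- The coordinates of a tangent field are smooth, being obtained from its inner products with the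
`∂_i ψ` by applying the inverse of the induced metric. -/
theorem contDiffOn_coordField (gW : MetricTensor W) (hψ : IsLocalParam S U ψ) (hB : ContDiff ℝ ∞ B)
    (ht : ∀ x ∈ U, B (ψ x) ∈ range (fderiv ℝ ψ x)) : ContDiffOn ℝ ∞ (coordField B ψ) U := by
  have hdet : ∀ x ∈ U, (inducedMetric gW ψ x).det ≠ 0 :=
    fun _ hx => (inducedMetric_det_pos gW hψ hx).ne'
  have e : EqOn (coordField B ψ) (fun x => WithLp.toLp 2 fun i =>
      ∑ j, (inducedMetric gW ψ x)⁻¹ i j * gW.form (partialDeriv j ψ x) (B (ψ x))) U := by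
    intro x hx
    ext i
    change _ = (inducedMetric gW ψ x)⁻¹.mulVec _ i
    have : (fun j => gW.form (partialDeriv j ψ x) (B (ψ x))) =
        (inducedMetric gW ψ x).mulVec (coordField B ψ x) := by
      ext j
      rw [← form_fderiv_eq_sum, fderiv_coordField (ht x hx)]
    rw [this, Matrix.mulVec_mulVec, Matrix.nonsing_inv_mul _ (isUnit_iff_ne_zero.2 (hdet x hx)),
      Matrix.one_mulVec]
  refine ContDiffOn.congr (contDiffOn_euclidean.2 fun i => ?_) e
  change ContDiffOn ℝ ∞ (fun x =>
    ∑ j, (inducedMetric gW ψ x)⁻¹ i j * gW.form (partialDeriv j ψ x) (B (ψ x))) U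
  exact ContDiffOn.sum fun j _ => (contDiffOn_matrix_inv (contDiffOn_inducedMetric gW hψ) hdet i j).mul
    (contDiffOn_form gW (contDiffOn_partialDeriv hψ.isOpen hψ.contDiffOn j)
      (hB.comp_contDiffOn hψ.contDiffOn))

end Param

/-! ### Analytic continuation and tangency -/

section Submanifold

/-- A parametrization identifies the neighbourhoods of a point with those of its image in `S`. -/
theorem IsLocalParam.map_nhds {W : Type*} [AddCommGroup W] [Module ℝ W] [TopologicalSpace W]
    {d : ℕ} {S : Set W} {U : Set (EuclideanSpace ℝ (Fin d))} {ψ : EuclideanSpace ℝ (Fin d) → W}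
    (hψ : IsLocalParam S U ψ) {x : EuclideanSpace ℝ (Fin d)} (hx : x ∈ U) :
    Filter.map ψ (𝓝 x) = 𝓝[S] (ψ x) := by
  have e := hψ.isOpenEmbedding.map_nhds_eq ⟨x, hx⟩
  rw [nhdsWithin_eq_map_subtype_coe (hψ.mapsTo hx), ← hψ.isOpen.nhdsWithin_eq hx,
    nhdsWithin_eq_map_subtype_coe hx, Filter.map_map]
  refine Eq.trans ?_ (congrArg (Filter.map Subtype.val) e)
  rw [Filter.map_map]
  rfl

theorem AnalyticAt.eventually_eq_of_iteratedFDeriv {F : Type*} [NormedAddCommGroup F]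
    [NormedSpace ℝ F] {f : F → ℝ} {x : F} (hf : AnalyticAt ℝ f x)
    (h : ∀ (y : F) (n : ℕ), iteratedFDeriv ℝ (n + 1) f x (fun _ => y) = 0) :
    ∀ᶠ z in 𝓝 x, f z = f x := by
  obtain ⟨p, r, hp⟩ := hf
  filter_upwards [Metric.eball_mem_nhds x hp.r_pos] with z hz
  have hs := hp.hasSum_iteratedFDeriv (y := z - x) (by
    rw [Metric.mem_eball, edist_eq_enorm_sub] at hz ⊢
    simpa using hz)
  have e := hs.unique (hasSum_single 0 fun n hn => by
    obtain ⟨k, rfl⟩ := Nat.exists_eq_succ_of_ne_zero hn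
    rw [h, smul_zero])
  simpa using e

/-- Analytic continuation along a connected analytic submanifold: an analytic function all of whose
derivatives vanish at one point is constant. -/
theorem eq_of_iteratedFDeriv_eq_zero {W : Type*} [AddCommGroup W] [Module ℝ W] [TopologicalSpace W]
    {d : ℕ} {S : Set W} (hS : IsAnalyticSubmanifold d S) (hconn : IsPreconnected S)
    {U : Set (EuclideanSpace ℝ (Fin d))} {ψ : EuclideanSpace ℝ (Fin d) → W}
    (hψ : IsLocalParam S U ψ) {x₀ : EuclideanSpace ℝ (Fin d)} (hx₀ : x₀ ∈ U) (l : StrongDual ℝ W)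
    (h : ∀ y n, iteratedFDeriv ℝ (n + 1) (fun x => l (ψ x)) x₀ (fun _ => y) = 0)
    {s₁ s₂ : W} (hs₁ : s₁ ∈ S) (hs₂ : s₂ ∈ S) : l s₁ = l s₂ := by
  have : PreconnectedSpace S := isPreconnected_iff_preconnectedSpace.1 hconn
  -- the set of points near which `l` is constant is open and closed in `S`
  let Z : Set S := {s | ∀ᶠ z : S in 𝓝 s, l z = l (ψ x₀)}
  have key {U' : Set (EuclideanSpace ℝ (Fin d))} {ψ' : EuclideanSpace ℝ (Fin d) → W}
      (hψ' : IsLocalParam S U' ψ') {x : EuclideanSpace ℝ (Fin d)} (hx : x ∈ U') :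
      (⟨ψ' x, hψ'.mapsTo hx⟩ : S) ∈ Z ↔ ∀ᶠ y in 𝓝 x, l (ψ' y) = l (ψ x₀) := by
    rw [← Filter.eventually_map (m := ψ') (P := fun z => l z = l (ψ x₀)), hψ'.map_nhds hx,
      nhdsWithin_eq_map_subtype_coe (hψ'.mapsTo hx), Filter.eventually_map]
    rfl
  have hne : Z.Nonempty := ⟨⟨ψ x₀, hψ.mapsTo hx₀⟩,
    (key hψ hx₀).2 ((hψ.analytic l x₀ hx₀).eventually_eq_of_iteratedFDeriv h)⟩
  have hclosed : IsClosed Z := by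
    refine isClosed_of_closure_subset fun s hs => ?_
    obtain ⟨U', ψ', hψ', x, hx, hxs⟩ := hS s s.2
    obtain rfl : s = ⟨ψ' x, hψ'.mapsTo hx⟩ := Subtype.ext hxs.symm
    obtain ⟨r, hr, hrU⟩ := Metric.isOpen_iff.1 hψ'.isOpen x hx
    have hO : IsOpen (hψ'.mapsTo.restrict ψ' U' S '' (Subtype.val ⁻¹' Metric.ball x r)) :=
      hψ'.isOpenEmbedding.isOpenMap _ (Metric.isOpen_ball.preimage continuous_subtype_val)
    have hmem : (⟨ψ' x, hψ'.mapsTo hx⟩ : S) ∈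
        hψ'.mapsTo.restrict ψ' U' S '' (Subtype.val ⁻¹' Metric.ball x r) :=
      mem_image_of_mem (hψ'.mapsTo.restrict ψ' U' S) (x := (⟨x, hx⟩ : U'))
        (a := Subtype.val ⁻¹' Metric.ball x r) (mem_preimage.2 (Metric.mem_ball_self hr))
    obtain ⟨_, ⟨y, hy, rfl⟩, hyZ⟩ := mem_closure_iff.1 hs _ hO hmem
    refine (key hψ' hx).2 ?_
    have hy' : (y : EuclideanSpace ℝ (Fin d)) ∈ Metric.ball x r := hy
    have hev : (fun z => l (ψ' z)) =ᶠ[𝓝 (y : EuclideanSpace ℝ (Fin d))] fun _ => l (ψ x₀) :=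
      (key hψ' y.2).1 hyZ
    have e := AnalyticOnNhd.eqOn_of_preconnected_of_eventuallyEq ((hψ'.analytic l).mono hrU)
      analyticOnNhd_const (convex_ball x r).isPreconnected hy' hev
    filter_upwards [Metric.ball_mem_nhds x hr] with z hz using e hz
  have huniv : Z = univ := IsClopen.eq_univ ⟨hclosed, isOpen_setOfPred_eventually_nhds⟩ hne
  have hc (s : S) : l s = l (ψ x₀) := by
    have hs : s ∈ Z := huniv ▸ mem_univ s
    exact (show ∀ᶠ z : S in 𝓝 s, l z = l (ψ x₀) from hs).self_of_nhds
  exact (hc ⟨s₁, hs₁⟩).trans (hc ⟨s₂, hs₂⟩).symm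

variable {W : Type*} [NormedAddCommGroup W] [NormedSpace ℝ W] [FiniteDimensional ℝ W] {d : ℕ}
  {S : Set W} {U : Set (EuclideanSpace ℝ (Fin d))} {ψ : EuclideanSpace ℝ (Fin d) → W}
  {B : W → W}

/-- A vector field whose flow preserves a submanifold is tangent to it. -/
theorem IsFlowInvariant.mem_range_fderiv (hψ : IsLocalParam S U ψ) (hB : ContDiff ℝ ∞ B)
    (hinv : IsFlowInvariant B S) {x : EuclideanSpace ℝ (Fin d)} (hx : x ∈ U) :
    B (ψ x) ∈ range (fderiv ℝ ψ x) := by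
  have := FiniteDimensional.complete ℝ W
  change B (ψ x) ∈ (fderiv ℝ ψ x).toLinearMap.range
  refine mem_of_forall_dual fun l' hl' => ?_
  let l : W →L[ℝ] ℝ := LinearMap.toContinuousLinearMap l'
  have hψd : HasFDerivAt ψ (fderiv ℝ ψ x) x :=
    ((hψ.contDiffOn.contDiffAt (hψ.isOpen.mem_nhds hx)).differentiableAt (by simp)).hasFDerivAt
  obtain ⟨α, hα0, δ, hδ, hα⟩ := (hB.contDiffAt.of_le (by simp : (1 : WithTop ℕ∞) ≤ ∞)
    (x := ψ x)).exists_forall_mem_closedBall_exists_eq_forall_mem_Ioo_hasDerivAt₀ 0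
  rw [zero_sub, zero_add] at hα
  have hα0' : HasDerivAt α (B (ψ x)) 0 := hα0 ▸ hα 0 ⟨by linarith, hδ⟩
  have hαS : ∀ t ∈ Ico 0 δ, α t ∈ S := fun t ht => hinv t α ht.1
    (fun s hs => (hα s ⟨by linarith [hs.1], hs.2.trans_lt ht.2⟩).hasDerivWithinAt)
    (hα0 ▸ hψ.mapsTo hx)
  have hev : ∀ᶠ t in 𝓝[>] (0 : ℝ), α t ∈ S := by
    filter_upwards [Ioo_mem_nhdsGT hδ] with t ht using hαS t ⟨ht.1.le, ht.2⟩
  have htend : Filter.Tendsto α (𝓝[>] 0) (𝓝[S] (ψ x)) := tendsto_nhdsWithin_iff.2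
    ⟨hα0 ▸ hα0'.continuousAt.tendsto.mono_left nhdsWithin_le_nhds, hev⟩
  -- along `S`, increments of `l` are of higher order than those of the position
  have hl : (fun z => l z - l (ψ x)) =o[𝓝[S] (ψ x)] fun z => z - ψ x := by
    rw [← hψ.map_nhds hx, Asymptotics.isLittleO_map]
    have h1 : (fun y => l (ψ y) - l (ψ x)) =o[𝓝 x] fun y => y - x := by
      refine ((l.isBigO_comp _ _).trans_isLittleO hψd.isLittleO).congr_left fun y => ?_
      have : l (fderiv ℝ ψ x (y - x)) = 0 := hl' _ ⟨y - x, rfl⟩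
      simp only [map_sub] at this ⊢
      linarith
    obtain ⟨K, -, hK⟩ := LinearMap.exists_antilipschitzWith (fderiv ℝ ψ x).toLinearMap
      (LinearMap.ker_eq_bot.2 (hψ.immersion x hx))
    exact h1.trans_isBigO (hψd.isTheta_sub
      (hK.isInducing (fderiv ℝ ψ x).continuous)).isBigO_symm
  have h2 : (fun t => l (α t) - l (ψ x)) =o[𝓝[>] 0] fun t : ℝ => t - 0 :=
    (hl.comp_tendsto htend).trans_isBigO
      ((hα0 ▸ hα0'.isBigO_sub).mono nhdsWithin_le_nhds)
  have h3 : HasDerivWithinAt (fun t => l (α t)) 0 (Ioi 0) 0 := by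
    rw [hasDerivWithinAt_iff_isLittleO]
    simpa [hα0] using h2
  exact ((uniqueDiffWithinAt_Ioi (0 : ℝ)).eq_deriv _
    (l.hasFDerivAt.comp_hasDerivAt 0 hα0').hasDerivWithinAt h3)

end Submanifold

/-! ### The characterization on a normed space -/

section Characterization

variable {E : Type*} [NormedAddCommGroup E] [NormedSpace ℝ E] [FiniteDimensional ℝ E]
  {G : Type*} [TopologicalSpace G] [ChartedSpace E G] [Group G] [LieGroup 𝓘(ℝ, E) ∞ G]
  {W : Type*} [NormedAddCommGroup W] [NormedSpace ℝ W] [FiniteDimensional ℝ W] {d : ℕ}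
  {S : Set W} {gW : MetricTensor W} {ρ : W → ℝ} {B : W → W} {ε : ℝ}

/-- The characterization for a linear velocity `v` and a smooth drift `B` on a normed space. -/
theorem fokkerPlanckHormander_iff (hS : IsAnalyticSubmanifold d S) (hconn : IsConnected S)
    (hB : ContDiff ℝ ∞ B) (hinv : IsFlowInvariant B S) (hρ : IsSmoothPositiveOn d S ρ)
    (hε : 0 < ε) (v : W →ₗ[ℝ] LieAlgOf E G) :
    FokkerPlanckHormander d S gW ρ (fun y => v y) B ε ↔ pHull (v '' S) = ⊤ := by
  have hvs {U : Set (EuclideanSpace ℝ (Fin d))} {ψ : EuclideanSpace ℝ (Fin d) → W}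
      (hψ : IsLocalParam S U ψ) : IsSmoothInto U fun x => v (ψ x) :=
    fun l => contDiffOn_linear_comp (l ∘ₗ v) hψ.contDiffOn
  constructor
  · intro h
    obtain ⟨y, hy⟩ := hconn.nonempty
    obtain ⟨U, ψ, hψ, x, hx, -⟩ := hS y hy
    exact pHull_eq_top_of_parabolicHormander hψ.mapsTo (hvs hψ) hx (h U ψ hψ)
  · rintro hp U ψ hψ ⟨a, x⟩ ⟨-, hx⟩
    have hx : x ∈ U := hx
    have hr : 0 < ε ^ 2 / 2 := by positivity
    obtain ⟨m, T, hT, hTT⟩ := exists_conformalMetric_eq gW hψ hρ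
    have hdet (x) (hx : x ∈ U) : (conformalMetric gW ρ ψ x).det ≠ 0 :=
      (conformalMetric_det_pos hψ hρ hx).ne'
    have hsdet (x) (hx : x ∈ U) : √(conformalMetric gW ρ ψ x).det ≠ 0 :=
      (Real.sqrt_pos.2 (conformalMetric_det_pos hψ hρ hx)).ne'
    have hs : ContDiffOn ℝ ∞ (fun x => √(conformalMetric gW ρ ψ x).det) U :=
      (contDiffOn_det (contDiffOn_conformalMetric hψ hρ)).sqrt hdet
    have hσ (k) := contDiffOn_diffusionFields (r := ε ^ 2 / 2)
      (contDiffOn_conformalMetric (gW := gW) hψ hρ) hdet hT k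
    have hspan := smoothlySpans_diffusionFields hr (contDiffOn_conformalMetric (gW := gW) hψ hρ)
      hdet hT hTT
    have hσh (x) (hx : x ∈ U) := sum_diffusionFields_mul hr.le (hdet x hx) (hTT x hx)
    have hb := contDiffOn_coordField gW hψ hB fun x hx => hinv.mem_range_fderiv hψ hB hx
    obtain ⟨U', hU'U, hU', hx', hfill⟩ := exists_parabolicLieModule_eq (G := G) hψ.isOpen (hvs hψ)
      (contDiffOn_driftField hψ.isOpen hb hsdet hs hσ).isSmoothInto
      hspan (fun x hx => mem_image_of_mem v (hψ.mapsTo hx)) hx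
      (by
        rintro l hl _ ⟨s₁, hs₁, rfl⟩ _ ⟨s₂, hs₂, rfl⟩
        exact eq_of_iteratedFDeriv_eq_zero hS hconn.isPreconnected hψ hx
          (LinearMap.toContinuousLinearMap (l ∘ₗ v)) hl hs₁ hs₂) hp
    exact ⟨univ ×ˢ U', isOpen_univ.prod hU', ⟨mem_univ _, hx'⟩, prod_mono_right hU'U, m, _, _,
      isSumOfSquares_fokkerPlanck hU' ((hvs hψ).mono hU'U) (hb.mono hU'U)
        (fun x hx => hsdet x (hU'U hx)) (hs.mono hU'U) (fun k => (hσ k).mono hU'U)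
        (fun x hx => hσh x (hU'U hx)), hfill a⟩

end Characterization

/-! ### The Euler-Arnold equation on the algebra and on its dual -/

theorem contDiff_bilinear_diag {W : Type*} [NormedAddCommGroup W] [NormedSpace ℝ W]
    [FiniteDimensional ℝ W] (β : W →ₗ[ℝ] W →ₗ[ℝ] W) : ContDiff ℝ ∞ fun y => β y y := by
  let b := Module.finBasis ℝ W
  have e : (fun y => β y y) = fun y => ∑ i, b.coord i y • β (b i) y := by
    ext1 y
    conv_lhs => enter [1]; rw [← b.sum_repr y]
    simp only [map_sum, map_smul, LinearMap.sum_apply, LinearMap.smul_apply,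
      Module.Basis.coord_apply]
  rw [e]
  exact ContDiff.sum fun i _ => (LinearMap.toContinuousLinearMap (b.coord i)).contDiff.smul
    (LinearMap.toContinuousLinearMap (β (b i))).contDiff

section Transport

variable {W W' : Type*} [NormedAddCommGroup W] [NormedSpace ℝ W] [NormedAddCommGroup W']
  [NormedSpace ℝ W'] {d : ℕ} {S : Set W} (e : W ≃L[ℝ] W')

theorem IsLocalParam.image {U : Set (EuclideanSpace ℝ (Fin d))}
    {ψ : EuclideanSpace ℝ (Fin d) → W} (hψ : IsLocalParam S U ψ) :
    IsLocalParam (e '' S) U (e ∘ ψ) where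
  isOpen := hψ.isOpen
  analytic l := hψ.analytic (l ∘L (e : W →L[ℝ] W'))
  immersion x hx := by
    rw [e.comp_fderiv]
    exact e.injective.comp (hψ.immersion x hx)
  mapsTo x hx := mem_image_of_mem e (hψ.mapsTo hx)
  isOpenEmbedding := (e.toHomeomorph.image S).isOpenEmbedding.comp hψ.isOpenEmbedding

theorem IsAnalyticSubmanifold.image (hS : IsAnalyticSubmanifold d S) :
    IsAnalyticSubmanifold d (e '' S) := by
  rintro _ ⟨y, hy, rfl⟩
  obtain ⟨U, ψ, hψ, x, hx, rfl⟩ := hS y hy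
  exact ⟨U, e ∘ ψ, hψ.image e, x, hx, rfl⟩

theorem IsSmoothPositiveOn.image {ρ : W → ℝ} (hρ : IsSmoothPositiveOn d S ρ) :
    IsSmoothPositiveOn d (e '' S) fun z => ρ (e.symm z) := by
  refine ⟨?_, fun U ψ hψ => hρ.2 U (e.symm ∘ ψ) ?_⟩
  · rintro _ ⟨y, hy, rfl⟩
    simpa using hρ.1 y hy
  · have h := hψ.image e.symm
    rwa [← image_comp, e.symm_comp_self, image_id] at h

theorem IsFlowInvariant.image {B : W → W} {B' : W' → W'} (hB : IsFlowInvariant B S)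
    (h : ∀ z, e.symm (B' z) = B (e.symm z)) : IsFlowInvariant B' (e '' S) := by
  rintro T y hT hy ⟨s, hs, hs0⟩
  refine ⟨e.symm (y T), hB T (fun t => e.symm (y t)) hT (fun t ht => ?_) ?_, by simp⟩
  · rw [← h]
    exact (e.symm.hasFDerivAt).comp_hasDerivWithinAt t (hy t ht)
  · simpa [← hs0] using hs

end Transport

section Normable

/-- The operations and the topology of `W` are those of some normed space. The Lie algebra, being a
tangent space, has no norm among its instances; with this predicate, results on normed spaces are
transferred to it by substitution. -/
def IsNormableSpace (W : Type*) [i : AddCommGroup W] [j : Module ℝ W] [t : TopologicalSpace W] :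
    Prop :=
  ∃ (n : NormedAddCommGroup W) (s : NormedSpace ℝ W),
    (⟨n.toAddCommGroup, s.toModule, n.toPseudoMetricSpace.toUniformSpace.toTopologicalSpace⟩ :
      Σ _ : AddCommGroup W, Module ℝ W × TopologicalSpace W) = ⟨i, j, t⟩

/-- The Lie algebra has the model space `E` as its underlying topological vector space. -/
theorem isNormableSpace_lieAlgOf (E : Type*) [NormedAddCommGroup E] [NormedSpace ℝ E]
    (G : Type*) [TopologicalSpace G] [ChartedSpace E G] [Group G] :
    IsNormableSpace (LieAlgOf E G) :=
  ⟨inferInstanceAs (NormedAddCommGroup E), inferInstanceAs (NormedSpace ℝ E), rfl⟩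

theorem IsNormableSpace.strongDual {V : Type*} [AddCommGroup V] [Module ℝ V] [TopologicalSpace V]
    (h : IsNormableSpace V) : IsNormableSpace (StrongDual ℝ V) := by
  obtain ⟨n, s, h⟩ := h
  cases h
  exact ⟨inferInstance, inferInstance, rfl⟩

variable {W W' : Type*} [AddCommGroup W] [Module ℝ W] [TopologicalSpace W] [AddCommGroup W']
  [Module ℝ W'] [TopologicalSpace W'] {d : ℕ} {S : Set W} (e : W ≃L[ℝ] W')

theorem IsNormableSpace.isAnalyticSubmanifold_image (hW : IsNormableSpace W)
    (hW' : IsNormableSpace W') (hS : IsAnalyticSubmanifold d S) :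
    IsAnalyticSubmanifold d (e '' S) := by
  obtain ⟨n, s, h⟩ := hW
  obtain ⟨n', s', h'⟩ := hW'
  cases h
  cases h'
  exact hS.image e

theorem IsNormableSpace.isSmoothPositiveOn_image (hW : IsNormableSpace W)
    (hW' : IsNormableSpace W') {ρ : W → ℝ} (hρ : IsSmoothPositiveOn d S ρ) :
    IsSmoothPositiveOn d (e '' S) fun z => ρ (e.symm z) := by
  obtain ⟨n, s, h⟩ := hW
  obtain ⟨n', s', h'⟩ := hW'
  cases h
  cases h'
  exact hρ.image e

theorem IsNormableSpace.isFlowInvariant_image [ContinuousSMul ℝ W] [ContinuousSMul ℝ W']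
    (hW : IsNormableSpace W) (hW' : IsNormableSpace W') {B : W → W} {B' : W' → W'}
    (hB : IsFlowInvariant B S) (hBB' : ∀ z, e.symm (B' z) = B (e.symm z)) :
    IsFlowInvariant B' (e '' S) := by
  obtain ⟨n, s, h⟩ := hW
  obtain ⟨n', s', h'⟩ := hW'
  cases h
  cases h'
  exact hB.image e hBB'

theorem IsNormableSpace.fokkerPlanckHormander_iff [ContinuousSMul ℝ W] [FiniteDimensional ℝ W]
    {E : Type*} [NormedAddCommGroup E] [NormedSpace ℝ E] [FiniteDimensional ℝ E]
    {G : Type*} [TopologicalSpace G] [ChartedSpace E G] [Group G] [LieGroup 𝓘(ℝ, E) ∞ G]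
    (hW : IsNormableSpace W) {gW : MetricTensor W} {ρ : W → ℝ} {B : W → W} {ε : ℝ}
    (hS : IsAnalyticSubmanifold d S) (hconn : IsConnected S)
    (hB : ∃ β : W →ₗ[ℝ] W →ₗ[ℝ] W, ∀ y, B y = β y y) (hinv : IsFlowInvariant B S)
    (hρ : IsSmoothPositiveOn d S ρ) (hε : 0 < ε) (v : W →ₗ[ℝ] LieAlgOf E G) :
    FokkerPlanckHormander d S gW ρ (fun y => v y) B ε ↔ pHull (v '' S) = ⊤ := by
  obtain ⟨n, s, h⟩ := hW
  cases h
  obtain ⟨β, hβ⟩ := hB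
  have hB : ContDiff ℝ ∞ B := by
    rw [show B = fun y => β y y from funext hβ]
    exact contDiff_bilinear_diag β
  exact _root_.fokkerPlanckHormander_iff hS hconn hB hinv hρ hε v

end Normable

section EulerArnold

variable {E : Type*} [NormedAddCommGroup E] [NormedSpace ℝ E] [FiniteDimensional ℝ E]
  {G : Type*} [TopologicalSpace G] [ChartedSpace E G] [Group G] [LieGroup 𝓘(ℝ, E) ∞ G]

theorem exists_bilinear_eulerArnold (g : MetricTensor (LieAlgOf E G)) :
    ∃ β : StrongDual ℝ (LieAlgOf E G) →ₗ[ℝ] StrongDual ℝ (LieAlgOf E G) →ₗ[ℝ]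
      StrongDual ℝ (LieAlgOf E G), ∀ y, eulerArnold g y = β y y := by
  refine ⟨LinearMap.mk₂ ℝ (fun y y' => LinearMap.toContinuousLinearMap
    (y'.toLinearMap ∘ₗ (LieAlgebra.ad ℝ (LieAlgOf E G) (g.sharp y))))
    (fun _ _ _ => ?_) (fun _ _ _ => ?_) (fun _ _ _ => ?_) (fun _ _ _ => ?_), fun _ => rfl⟩ <;>
  · ext w
    simp

theorem symmArnoldForm_self (g : MetricTensor (LieAlgOf E G)) (z : LieAlgOf E G) :
    symmArnoldForm g z z = arnoldForm g z z := by
  rw [symmArnoldForm, ← two_smul ℝ (arnoldForm g z z), smul_smul]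
  norm_num

/-- Lowering indices turns the Euler-Arnold equation on `𝔤` into the one on `𝔤*`. -/
theorem flat_symmArnoldForm (g : MetricTensor (LieAlgOf E G)) (z : LieAlgOf E G) :
    g.flat (symmArnoldForm g z z) = eulerArnold g (g.flat z) := by
  rw [symmArnoldForm_self, arnoldForm, eulerArnold, MetricTensor.sharp,
    LinearEquiv.apply_symm_apply, LinearEquiv.symm_apply_apply]
  rfl

theorem exists_bilinear_symmArnoldForm (g : MetricTensor (LieAlgOf E G)) :
    ∃ β : LieAlgOf E G →ₗ[ℝ] LieAlgOf E G →ₗ[ℝ] LieAlgOf E G,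
      ∀ z, symmArnoldForm g z z = β z z := by
  obtain ⟨β, hβ⟩ := exists_bilinear_eulerArnold g
  refine ⟨(β.compl₁₂ g.flat.toLinearMap g.flat.toLinearMap).compr₂ g.sharp.toLinearMap,
    fun z => ?_⟩
  have := congrArg g.sharp ((flat_symmArnoldForm g z).trans (hβ _))
  rwa [MetricTensor.sharp, LinearEquiv.symm_apply_apply] at this

end EulerArnold

end

theorem theorem2 {E : Type*} [NormedAddCommGroup E] [NormedSpace ℝ E] [FiniteDimensional ℝ E]
    {G : Type*} [TopologicalSpace G] [ChartedSpace E G] [Group G] [LieGroup 𝓘(ℝ, E) ∞ G]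
    (g : MetricTensor (LieAlgOf E G)) (d : ℕ) (M : Set (StrongDual ℝ (LieAlgOf E G)))
    (hM : IsAnalyticSubmanifold d M) (hconn : IsConnected M)
    (hinv : IsFlowInvariant (eulerArnold g) M)
    (ρ : StrongDual ℝ (LieAlgOf E G) → ℝ) (hρ : IsSmoothPositiveOn d M ρ)
    (ε : ℝ) (hε : 0 < ε) :
    (FokkerPlanckHormander d M g.dual ρ (fun y => g.sharp y) (eulerArnold g) ε ↔
      pHull (g.sharp '' M) = ⊤) ∧
    (FokkerPlanckHormander d (g.sharp '' M) g (fun z => ρ (g.flat z)) (fun z => z)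
        (fun z => symmArnoldForm g z z) ε ↔
      pHull (g.sharp '' M) = ⊤) := by
  have hV := isNormableSpace_lieAlgOf E G
  refine ⟨hV.strongDual.fokkerPlanckHormander_iff hM hconn (exists_bilinear_eulerArnold g) hinv hρ
    hε g.sharp.toLinearMap, ?_⟩
  let e : StrongDual ℝ (LieAlgOf E G) ≃L[ℝ] LieAlgOf E G := g.sharp.toContinuousLinearEquiv
  have h := hV.fokkerPlanckHormander_iff (gW := g)
    (hV.strongDual.isAnalyticSubmanifold_image e hV hM)
    (hconn.image e e.continuous.continuousOn) (exists_bilinear_symmArnoldForm g)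
    (hV.strongDual.isFlowInvariant_image e hV hinv fun z => flat_symmArnoldForm g z)
    (hV.strongDual.isSmoothPositiveOn_image e hV hρ) hε LinearMap.id
  rwa [show ((LinearMap.id : LieAlgOf E G →ₗ[ℝ] LieAlgOf E G) '' (e '' M)) = g.sharp '' M from
    image_id _] at h
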